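/- Let $n\ge 1$. For a finite alphabet $\Sigma$ with a distinguished empty state $0$, let $\mathcal C_\Sigma$ be the set of maps $c:\mathbb Z^n\to\Sigma$ with $c_i\neq 0$ for only finitely many $i$, and let $\mathcal H_\Sigma^{\mathbb Z^n}$ be the Hilbert space with orthonormal basis $\{|c\rangle\}_{c\in\mathcal C_\Sigma}$; write $|\mathbf 0\rangle$ for the basis vector of the all-empty configuration. A *QCA* over $\Sigma$ is a unitary operator $G$ on $\mathcal H_\Sigma^{\mathbb Z^n}$ that commutes with the unit translations along the $n$ axes and is causal: there is a finite $\mathcal N\subset\mathbb Z^n$ such that for every cell $x$ there is a function $f$ with $(G\rho G^\dagger)_x=f(\rho_{x+\mathcal N})$ for every density matrix $\rho$, where $\rho_S$ denotes the partial trace of $\rho$ over all cells outside $S$. A *PQCA* over a finite alphabet $\Lambda\ni 0$ is induced by a scattering unitary $U$ on $(\mathbb C^{\Lambda})^{\otimes 2^n}$ with $U|0\ldots0\rangle=|0\ldots0\rangle$. Let $J=\bigotimes_{2\mathbb Z^n}U$, acting on each hypercube $2x+\{0,1\}^n$, and let $\tau$ be the translation along $(1,\ldots,1)$. The PQCA evolves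 by $J$ at even steps $t=0,2,\ldots$ and by $\tau^\dagger J\tau$ at odd steps; $H_U^{(k)}$ denotes its evolution over its first $k$ steps. For an operator $T$ and $s\ge1$, let $T_{[s]}$ be $T$ viewed as acting on configurations of supercells, each hypercube $sx+\{0,\ldots,s-1\}^n$ being one supercell (whose empty state is the word $0\ldots0$). The PQCA *intrinsically simulates* an operator $G$ if there are integers $s\ge 1$, even $s'\ge 2$, even $k\ge 2$ and an isometry $E_0:\mathbb C^{\Sigma^{s^n}}\to\mathbb C^{\Lambda^{s'^n}}$ with $E_0|0\ldots0\rangle=|0\ldots0\rangle$ such that $E=\bigotimes_{\mathbb Z^n}E_0$ satisfies $$\bigl(H_U^{(k)}\bigr)_{[s']}\,E=E\,G_{[s]} .$$ **Theorem (PQCA are intrinsically universal).** For every $n$-dimensional QCA $G$ there are a complex number $z$ with $|z|=1$ and $zG|\mathbf 0\rangle=|\mathbf 0\rangle$ (so $z=1$ if $G|\mathbf 0\rangle=|\mathbf 0\rangle$) and an $n$-dimensional PQCA that intrinsically simulates $zG$. -/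

import Mathlib

universe u v

noncomputable section

namespace QCA

open scoped Matrix

/-! ### Configurations and state space -/

/-- The grid of cells. -/
abbrev Grid (n : ℕ) : Type := Fin n → ℤ

/-- Configurations: maps from the grid to the alphabet `A` that take the empty state `0` on all but
finitely many cells. -/
abbrev Config (n : ℕ) (A : Type u) [Zero A] : Type u := Grid n →₀ A

/-- The Hilbert space `ℓ²` having the set `X` as an orthonormal basis. -/
abbrev L2 (X : Type u) : Type u := lp (fun _ : X => ℂ) 2

/-- The Hilbert space of configurations. -/
abbrev StateSpace (n : ℕ) (A : Type u) [Zero A] : Type u := L2 (Config n A)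

/-- Bounded operators over the Hilbert space of configurations. -/
abbrev Op (n : ℕ) (A : Type u) [Zero A] : Type u := StateSpace n A →L[ℂ] StateSpace n A

open Classical in
/-- The basis vector `|x⟩`. -/
def ket {X : Type u} (x : X) : L2 X := lp.single 2 x 1

theorem memℓp_comp {X : Type u} {Y : Type v} (e : Y ≃ X) {f : X → ℂ} (h : Memℓp f 2) :
    Memℓp (fun y => f (e y)) 2 := by
  rw [memℓp_gen_iff (by norm_num)] at h ⊢
  exact h.comp_injective e.injective

/-- The unitary `|x⟩ ↦ |e x⟩` induced by a bijection `e` of the basis labels. -/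
def relabel {X : Type u} {Y : Type v} (e : X ≃ Y) : L2 X ≃ₗᵢ[ℂ] L2 Y where
  toFun f := ⟨fun y => f (e.symm y), memℓp_comp e.symm (lp.memℓp f)⟩
  invFun g := ⟨fun x => g (e x), memℓp_comp e (lp.memℓp g)⟩
  left_inv f := by ext x; simp
  right_inv g := by ext y; simp
  map_add' f g := rfl
  map_smul' a f := rfl
  norm_map' f := by
    rw [lp.norm_eq_tsum_rpow (by norm_num), lp.norm_eq_tsum_rpow (by norm_num)]
    congr 1
    exact e.symm.tsum_eq (fun x => ‖f x‖ ^ (2 : ENNReal).toReal)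

theorem relabel_ket {X : Type u} {Y : Type v} (e : X ≃ Y) (x : X) :
    relabel e (ket x) = ket (e x) := by
  classical
  ext y
  change (ket x : L2 X) (e.symm y) = (ket (e x) : L2 Y) y
  simp only [ket, lp.single_apply, Pi.single_apply, Equiv.symm_apply_eq]

/-- Conjugation of an operator by `relabel e`. -/
def conjRelabel {X : Type u} {Y : Type v} (e : X ≃ Y) (T : L2 X →L[ℂ] L2 X) :
    L2 Y →L[ℂ] L2 Y :=
  (relabel e : L2 X →L[ℂ] L2 Y) ∘L T ∘L ((relabel e).symm : L2 Y →L[ℂ] L2 X)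

/-! ### Quantum cellular automata -/

section Basic

variable {n : ℕ} {A : Type u} [Zero A]

/-- The translation of configurations along `v`: `c'_i = c_{i + v}`. -/
def shift (v : Grid n) : Config n A ≃ Config n A where
  toFun c := Finsupp.equivMapDomain (Equiv.subRight v) c
  invFun c := Finsupp.equivMapDomain (Equiv.addRight v) c
  left_inv c := by ext i; simp
  right_inv c := by ext i; simp

theorem shift_apply (v : Grid n) (c : Config n A) (i : Grid n) : shift v c i = c (i + v) := rfl

/-- The translation operator along `v`. -/
def translation (v : Grid n) : StateSpace n A ≃ₗᵢ[ℂ] StateSpace n A := relabel (shift v)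

variable (n A) in
/-- The diagonal translation `τ = τ₁ ⋯ τₙ`. -/
def diag : StateSpace n A ≃ₗᵢ[ℂ] StateSpace n A := translation (fun _ => 1)

/-- Translation-invariance: commutation with the unit translation along each dimension. -/
def TranslationInvariant (G : Op n A) : Prop :=
  ∀ (k : Fin n) (ψ : StateSpace n A),
    G (translation (Pi.single k 1) ψ) = translation (Pi.single k 1) (G ψ)

/-- Density matrices: positive operators of trace one. -/
def IsDensity (ρ : Op n A) : Prop :=
  ρ.IsPositive ∧ HasSum (fun c : Config n A => inner ℂ (ket c) (ρ (ket c))) 1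

open Classical in
/-- The configuration that coincides with `a` on `S` and with `e` outside of `S`. -/
def glue (S : Finset (Grid n)) (a : S → A) (e : Config n A) : Config n A :=
  Finsupp.onFinset (S ∪ e.support) (fun x => if h : x ∈ S then a ⟨x, h⟩ else e x) (by
    intro x hx
    by_cases h : x ∈ S
    · simp [h]
    · simpa [h] using hx)

theorem glue_injective (T : Finset (Grid n)) :
    Function.Injective fun a : T → A => glue T a 0 := by
  intro a b h
  ext x
  have := DFunLike.congr_fun h x.1
  simpa [glue] using this

theorem mem_range_glue (T : Finset (Grid n)) (d : Config n A) (h : d.support ⊆ T) :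
    d ∈ Set.range fun a : T → A => glue T a 0 := by
  refine ⟨fun x => d x, ?_⟩
  ext x
  by_cases hx : x ∈ T
  · simp [glue, hx]
  · have : d x = 0 := Finsupp.notMem_support_iff.1 fun h' => hx (h h')
    simp [glue, hx, this]

theorem support_glue (T : Finset (Grid n)) (a : T → A) : (glue T a 0).support ⊆ T := by
  intro x hx
  by_contra h
  simp [glue, h] at hx

/-- The reduced density matrix of `ρ` on the finite set of cells `S`, i.e. the partial trace over all
cells outside of `S`: its `(a, b)` entry is `∑ₑ ⟨a e| ρ |b e⟩`, where `e` ranges over the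
configurations of the complement of `S` (those which are empty on `S`). -/
def reduced (S : Finset (Grid n)) (ρ : Op n A) : Matrix (S → A) (S → A) ℂ :=
  fun a b => ∑' e : {e : Config n A // ∀ x ∈ S, e x = 0},
    inner ℂ (ket (glue S a e.1)) (ρ (ket (glue S b e.1)))

/-- Causality with neighbourhood `N`: the reduced density matrix of each cell `x` after the evolution
is a function of the reduced density matrix of the cells `x + N` before. -/
def CausalWith (N : Finset (Grid n)) (G : Op n A) : Prop :=
  ∀ x : Grid n, ∃ f : Matrix (N.map (addLeftEmbedding x) → A) (N.map (addLeftEmbedding x) → A) ℂ →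
      Matrix (({x} : Finset (Grid n)) → A) (({x} : Finset (Grid n)) → A) ℂ,
    ∀ ρ : Op n A, IsDensity ρ →
      reduced {x} (G ∘L ρ ∘L G.adjoint) = f (reduced (N.map (addLeftEmbedding x)) ρ)

/-- A quantum cellular automaton: a unitary, translation-invariant operator that is causal with some
finite neighbourhood. -/
structure IsQCA (G : Op n A) : Prop where
  unitary : G ∈ unitary (Op n A)
  translationInvariant : TranslationInvariant G
  causal : ∃ N : Finset (Grid n), CausalWith N G

end Basic

/-! ### Homogeneous tensor products of quiescence-preserving local isometries -/

/-- An isometry from `ℂ^A` to `ℂ^B` that preserves quiescence, i.e. maps `|0⟩` to `|0⟩`; it is given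
by its matrix. -/
structure LocalIsometry (A : Type u) (B : Type v) [Fintype A] [Zero A] [DecidableEq A]
    [Fintype B] [Zero B] [DecidableEq B] where
  mat : Matrix B A ℂ
  isometry : matᴴ * mat = 1
  quiescent : mat *ᵥ Pi.single 0 1 = Pi.single 0 1

namespace LocalIsometry

variable {A : Type u} {B : Type v} [Fintype A] [Zero A] [DecidableEq A]
  [Fintype B] [Zero B] [DecidableEq B] {n : ℕ}

theorem mat_zero (V : LocalIsometry A B) (b : B) : V.mat b 0 = if b = 0 then 1 else 0 := by
  have h := congrFun V.quiescent b
  simpa [Pi.single_apply] using h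

/-- The amplitude `⟨d| ⨂ V |c⟩`; all but finitely many factors are `⟨0|V|0⟩ = 1`. -/
def amplitude (V : LocalIsometry A B) (c : Config n A) (d : Config n B) : ℂ :=
  ∏ᶠ x, V.mat (d x) (c x)

theorem amplitude_eq_zero (V : LocalIsometry A B) (c : Config n A) (d : Config n B)
    (h : ¬ d.support ⊆ c.support) : V.amplitude c d = 0 := by
  obtain ⟨x, hxd, hxc⟩ := Finset.not_subset.1 h
  refine finprod_eq_zero _ x ?_ ?_
  · rw [Finsupp.notMem_support_iff.1 hxc, V.mat_zero, if_neg (Finsupp.mem_support_iff.1 hxd)]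
  · refine (c.support ∪ d.support).finite_toSet.subset fun y hy => ?_
    by_contra hy'
    simp only [Finset.coe_union, Set.mem_union, Finset.mem_coe, Finsupp.mem_support_iff,
      not_or, not_not] at hy'
    exact hy (by simp [hy'.1, hy'.2, V.mat_zero])

theorem amplitude_eq_prod (V : LocalIsometry A B) (T : Finset (Grid n)) (c : Config n A)
    (d : Config n B) (hc : c.support ⊆ T) (hd : d.support ⊆ T) :
    V.amplitude c d = ∏ x : T, V.mat (d x) (c x) := by
  rw [Finset.prod_coe_sort T (fun x => V.mat (d x) (c x))]
  refine finprod_eq_prod_of_mulSupport_subset _ fun y hy => ?_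
  by_contra hy'
  have h1 : c y = 0 := Finsupp.notMem_support_iff.1 fun h => hy' (hc h)
  have h2 : d y = 0 := Finsupp.notMem_support_iff.1 fun h => hy' (hd h)
  exact hy (by simp [h1, h2, V.mat_zero])

/-- The vector `⨂ V |c⟩`. -/
def column (V : LocalIsometry A B) (c : Config n A) : StateSpace n B :=
  ⟨fun d => V.amplitude c d, by
    refine (memℓp_zero ?_).of_exponent_ge zero_le
    refine (Set.finite_range fun a : c.support → B => glue c.support a 0).subset fun d hd => ?_
    refine mem_range_glue _ _ ?_
    by_contra h
    exact hd (V.amplitude_eq_zero c d h)⟩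

theorem orthonormal_column (V : LocalIsometry A B) :
    Orthonormal ℂ (V.column : Config n A → StateSpace n B) := by
  classical
  rw [orthonormal_iff_ite]
  intro c c'
  set T := c.support ∪ c'.support with hT
  have hc : c.support ⊆ T := Finset.subset_union_left
  have hc' : c'.support ⊆ T := Finset.subset_union_right
  rw [lp.inner_eq_tsum]
  rw [← (glue_injective (A := B) T).tsum_eq]
  · rw [tsum_fintype]
    have key : ∀ a : T → B, inner ℂ (V.column c (glue T a 0)) (V.column c' (glue T a 0)) =
        ∏ x : T, star (V.mat (a x) (c x)) * V.mat (a x) (c' x) := by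
      intro a
      change inner ℂ (V.amplitude c (glue T a 0)) (V.amplitude c' (glue T a 0)) = _
      rw [V.amplitude_eq_prod T c _ hc (support_glue T a),
        V.amplitude_eq_prod T c' _ hc' (support_glue T a), Finset.prod_mul_distrib]
      simp [glue, mul_comm]
    rw [Finset.sum_congr rfl fun a _ => key a,
      ← Fintype.prod_sum fun (x : T) (b : B) => star (V.mat b (c x)) * V.mat b (c' x)]
    have h2 : ∀ x : T, ∑ b, star (V.mat b (c x)) * V.mat b (c' x) =
        if c x = c' x then 1 else 0 := by
      intro x
      have := congrFun (congrFun V.isometry (c x)) (c' x)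
      simpa [Matrix.mul_apply, Matrix.one_apply] using this
    rw [Finset.prod_congr rfl fun x _ => h2 x]
    split_ifs with h
    · simp [h]
    · obtain ⟨x, hx⟩ : ∃ x, c x ≠ c' x := by
        by_contra! h'
        exact h (Finsupp.ext h')
      have hxT : x ∈ T := by
        by_contra h'
        exact hx ((Finsupp.notMem_support_iff.1 fun h1 => h' (hc h1)).trans
          (Finsupp.notMem_support_iff.1 fun h1 => h' (hc' h1)).symm)
      exact Finset.prod_eq_zero (Finset.mem_univ (⟨x, hxT⟩ : T)) (if_neg hx)
  · intro d hd
    refine mem_range_glue T d ?_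
    by_contra h
    refine hd ?_
    have : V.column c d = 0 := V.amplitude_eq_zero c d fun h' => h (h'.trans hc)
    simp [this]

/-- The isometry `⨂_{ℤⁿ} V` between Hilbert spaces of configurations. -/
def tensor (n : ℕ) (V : LocalIsometry A B) : StateSpace n A →L[ℂ] StateSpace n B :=
  (V.orthonormal_column (n := n)).orthogonalFamily.linearIsometry.toContinuousLinearMap

theorem tensor_ket (V : LocalIsometry A B) (c : Config n A) (d : Config n B) :
    V.tensor n (ket c) d = ∏ᶠ x, V.mat (d x) (c x) := by
  classical
  have h : V.tensor n (ket c) = V.column c := by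
    have := (V.orthonormal_column (n := n)).orthogonalFamily.linearIsometry_apply_single
      (i := c) (1 : ℂ)
    simp only [LinearIsometry.toSpanSingleton_apply, one_smul] at this
    rw [← this]
    simp only [tensor, ket, LinearIsometry.coe_toContinuousLinearMap]
    congr!
  rw [h]
  rfl

end LocalIsometry

/-! ### Grouping cells into supercells -/

/-- The alphabet of hypercubic supercells of side `s`: words over `A` indexed by `{0, …, s-1}ⁿ`. Its
empty state is the word `0…0`. -/
abbrev Block (n s : ℕ) (A : Type u) : Type u := (Fin n → Fin s) → A

section Grouping

variable {n : ℕ} {A : Type u} [Zero A]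

/-- Position `s x + p` of the `p`-th cell of the supercell `x`. -/
def cellAt (s : ℕ) (x : Grid n) (p : Fin n → Fin s) : Grid n := fun i => s * x i + (p i : ℕ)

/-- The supercell of the cell `y`. -/
def supercellOf (s : ℕ) (y : Grid n) : Grid n := fun i => y i / s

/-- The position of the cell `y` within its supercell. -/
def offsetOf (s : ℕ) [NeZero s] (y : Grid n) : Fin n → Fin s := fun i =>
  ⟨(y i % s).toNat, by
    have hs : (0 : ℤ) < s := by exact_mod_cast Nat.pos_of_ne_zero (NeZero.ne s)
    have h1 := Int.emod_lt_of_pos (y i) hs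
    have h2 := Int.emod_nonneg (y i) hs.ne'
    omega⟩

theorem cellAt_of (s : ℕ) [NeZero s] (y : Grid n) :
    cellAt s (supercellOf s y) (offsetOf s y) = y := by
  funext i
  have hs : (s : ℤ) ≠ 0 := by exact_mod_cast NeZero.ne s
  have h2 := Int.emod_nonneg (y i) hs
  simp only [cellAt, supercellOf, offsetOf, Int.toNat_of_nonneg h2]
  exact Int.mul_ediv_add_emod (y i) s

theorem supercellOf_cellAt (s : ℕ) [NeZero s] (x : Grid n) (p : Fin n → Fin s) :
    supercellOf s (cellAt s x p) = x := by
  funext i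
  have hs : (s : ℤ) ≠ 0 := by exact_mod_cast NeZero.ne s
  have h : ((p i : ℕ) : ℤ) / s = 0 :=
    Int.ediv_eq_zero_of_lt (by positivity) (by exact_mod_cast (p i).2)
  simp only [cellAt, supercellOf]
  rw [Int.mul_add_ediv_left _ _ hs, h, add_zero]

theorem offsetOf_cellAt (s : ℕ) [NeZero s] (x : Grid n) (p : Fin n → Fin s) :
    offsetOf s (cellAt s x p) = p := by
  funext i
  have h : ((p i : ℕ) : ℤ) % s = (p i : ℕ) :=
    Int.emod_eq_of_lt (by positivity) (by exact_mod_cast (p i).2)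
  apply Fin.ext
  simp only [cellAt, offsetOf, Int.mul_add_emod_self_left, h, Int.toNat_natCast]

/-- Grouping each hypercube of `sⁿ` adjacent cells of a configuration into one supercell. -/
def group (s : ℕ) [NeZero s] : Config n A ≃ Config n (Block n s A) where
  toFun c := Finsupp.ofSupportFinite (fun x p => c (cellAt s x p)) (by
    refine (c.support.finite_toSet.image (supercellOf s)).subset fun x hx => ?_
    obtain ⟨p, hp⟩ := Function.ne_iff.1 hx
    exact ⟨cellAt s x p, Finsupp.mem_support_iff.2 hp, supercellOf_cellAt s x p⟩)
  invFun d := Finsupp.ofSupportFinite (fun y => d (supercellOf s y) (offsetOf s y)) (by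
    refine ((d.support.finite_toSet.prod Set.finite_univ).image
      (fun q : Grid n × (Fin n → Fin s) => cellAt s q.1 q.2)).subset fun y hy => ?_
    refine ⟨(supercellOf s y, offsetOf s y), ⟨?_, Set.mem_univ _⟩, cellAt_of s y⟩
    refine Finsupp.mem_support_iff.2 fun h => hy ?_
    simp [h])
  left_inv c := by
    ext y
    simp [Finsupp.ofSupportFinite_coe, cellAt_of]
  right_inv d := by
    ext x p
    simp [Finsupp.ofSupportFinite_coe, supercellOf_cellAt, offsetOf_cellAt]

/-- The operator `T` seen as an operator over configurations of supercells of side `s`. -/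
def grouped (s : ℕ) [NeZero s] (T : Op n A) : Op n (Block n s A) := conjRelabel (group s) T

end Grouping

/-! ### Partitioned quantum cellular automata -/

/-- Scattering unitaries: unitary operators on the hypercubes of `2ⁿ` cells that preserve
quiescence. -/
structure ScatteringUnitary (n : ℕ) (A : Type u) [Fintype A] [Zero A] [DecidableEq A] where
  mat : Matrix (Block n 2 A) (Block n 2 A) ℂ
  unitary : mat ∈ Matrix.unitaryGroup (Block n 2 A) ℂ
  quiescent : mat *ᵥ Pi.single 0 1 = Pi.single 0 1

namespace ScatteringUnitary

variable {n : ℕ} {A : Type u} [Fintype A] [Zero A] [DecidableEq A]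

/-- A scattering unitary as an isometry of the space of one hypercube. -/
def toLocalIsometry (U : ScatteringUnitary n A) : LocalIsometry (Block n 2 A) (Block n 2 A) where
  mat := U.mat
  isometry := Matrix.mem_unitaryGroup_iff'.1 U.unitary
  quiescent := U.quiescent

/-- `J = ⨂_{2ℤⁿ} U`, applying `U` to each of the hypercubes `2x + {0,1}ⁿ`. -/
def J (U : ScatteringUnitary n A) : Op n A :=
  conjRelabel (group 2).symm (U.toLocalIsometry.tensor n)

/-- The evolution of the PQCA at time step `t`: `J` at even steps and `τ† J τ` at odd steps. -/
def step (U : ScatteringUnitary n A) (t : ℕ) : Op n A :=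
  if Even t then U.J
  else ((diag n A).symm : StateSpace n A →L[ℂ] StateSpace n A) ∘L U.J ∘L
    (diag n A : StateSpace n A →L[ℂ] StateSpace n A)

/-- The global evolution of the PQCA over its first `t` steps. -/
def evolution (U : ScatteringUnitary n A) : ℕ → Op n A
  | 0 => ContinuousLinearMap.id ℂ _
  | t + 1 => U.step t ∘L U.evolution t

end ScatteringUnitary

/-! ### Simulation -/

section Simulation

variable {n : ℕ} {A : Type u} [Fintype A] [Zero A] [DecidableEq A]
  {B : Type v} [Fintype B] [Zero B] [DecidableEq B]

/-- `H` directly simulates `G`: there is a cellwise, quiescence-preserving isometric encoding `E` with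
`H E = E G`. -/
def DirectlySimulates (H : Op n B) (G : Op n A) : Prop :=
  ∃ E : LocalIsometry A B, H ∘L E.tensor n = E.tensor n ∘L G

/-- The PQCA of scattering unitary `U` intrinsically simulates `G`: once cells have been grouped into
supercells (of side `s` for `G` and `s'` for the PQCA), `k` steps of the PQCA directly simulate one
step of `G`. As a PQCA is homogeneous over two time steps and two cells, `k` and `s'` are required to
be even, so that the evolution over any `k i` steps is the `i`-th power of the one over `k` steps, and
that it is invariant under translations of the supercells. -/
def IntrinsicallySimulates (U : ScatteringUnitary n B) (G : Op n A) : Prop :=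
  ∃ (s s' k : ℕ) (_ : NeZero s) (_ : NeZero s'), Even s' ∧ Even k ∧ 0 < k ∧
    DirectlySimulates (grouped s' (U.evolution k)) (grouped s G)

end Simulation

end QCA

end

-- Take two layers of the grid and let `S_x` exchange them at the cell `x`. The conjugates `K_x =
-- (G† ⊗ 1) S_x (G ⊗ 1)` commute, and their product over all cells is `(G† ⊗ 1) S (G ⊗ 1)`, with `S`
-- the full exchange. If `G|0⟩ = |0⟩`, this product sends `ψ ⊗ |0⟩` to `|0⟩ ⊗ Gψ`, and one more
-- exchange gives `Gψ ⊗ |0⟩`. Since `S_x = ∑ |u⟩⟨v| ⊗ |v⟩⟨u|`, the operator `K_x` is a gate on the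
-- cells near `x` as soon as each `G† |u⟩⟨v|_x G` is. Windows of side `2r+1` at a fixed offset are
-- disjoint and contain the neighbourhood of radius `r` of their centres, and the `(2r+1)^n` offsets
-- reach each cell exactly once. So `G` is a finite-depth circuit of translated block gates.
--
-- Locality of `G† |u⟩⟨v|_x G` comes from causality of reduced states by polarization
-- (`CausalWith.isLocalOn`). The circuit identity (`HasRadius.circuit_apply`) is handled through the
-- amplitudes `((G ⊗ 1)Ψ)(b, β) = G (restrict (withSecond β) Ψ) b`, on which a layer of gates merely
-- exchanges letters of `b` and `β` (`HasRadius.map_restrict_tensor_gate`).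
--
-- A PQCA runs such a circuit (`exists_evolution_eq_circuit`) with one hypercube per supercell. An
-- even step distributes the letters of a supercell over the corners of its hypercube, so that each
-- shifted hypercube of the next odd step holds exactly one window of the desired offset, to which
-- the gate is applied. A single scattering unitary performs all these different steps because the
-- data moves along cyclic tracks that serve as a clock.
--
-- Finally, a translation-invariant square-summable vector is a multiple of `|0⟩`, so a phase makes
-- any QCA quiescent (`IsQCA.exists_phase`).

universe w

noncomputable section

namespace QCA

open scoped Matrix

/-! ### Basis vectors, and the isometries induced by injections of basis labels -/

section Ket

variable {X : Type u} {Y : Type v} {Z : Type w}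

theorem ket_apply [DecidableEq X] (x y : X) : (ket x : L2 X) y = if y = x then 1 else 0 := by
  simp only [ket, lp.single_apply, Pi.single_apply]
  congr

theorem inner_ket_left (x : X) (φ : L2 X) : inner ℂ (ket x) φ = φ x := by
  simp [ket, lp.inner_single_left]

theorem norm_ket (x : X) : ‖(ket x : L2 X)‖ = 1 := by
  simp [ket, lp.norm_single]

theorem hasSum_ket (φ : L2 X) : HasSum (fun x => φ x • ket x) φ := by
  classical
  have h := lp.hasSum_single (p := 2) (by norm_num) φ
  convert h using 2 with x
  ext y
  rw [lp.coeFn_smul, Pi.smul_apply, ket_apply, lp.single_apply, Pi.single_apply]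
  split_ifs with h
  · subst h; simp
  · simp

theorem clm_ext_ket {F : Type*} [NormedAddCommGroup F] [NormedSpace ℂ F] {S T : L2 X →L[ℂ] F}
    (h : ∀ x, S (ket x) = T (ket x)) : S = T := by
  ext φ
  have h1 := (hasSum_ket φ).mapL S
  have h2 := (hasSum_ket φ).mapL T
  simp only [map_smul, h] at h1 h2
  exact h1.unique h2

theorem orthonormal_ket : Orthonormal ℂ (ket : X → L2 X) := by
  classical
  rw [orthonormal_iff_ite]
  intro x y
  rw [inner_ket_left, ket_apply]

theorem inner_ket_ket [DecidableEq X] (x y : X) :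
    inner ℂ (ket x : L2 X) (ket y) = if x = y then 1 else 0 := by
  rw [inner_ket_left, ket_apply]

/-- The isometry `|x⟩ ↦ |f x⟩` induced by an injection of the basis labels. -/
def embed (f : X ↪ Y) : L2 X →L[ℂ] L2 Y :=
  (orthonormal_ket.comp f f.injective).orthogonalFamily.linearIsometry.toContinuousLinearMap

@[simp]
theorem embed_ket (f : X ↪ Y) (x : X) : embed f (ket x) = ket (f x) := by
  classical
  have := (orthonormal_ket.comp f f.injective).orthogonalFamily.linearIsometry_apply_single
    (i := x) (1 : ℂ)
  simp only [LinearIsometry.toSpanSingleton_apply, one_smul] at this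
  rw [← Function.comp_apply (f := ket) (g := f), ← this]
  simp only [embed, ket, LinearIsometry.coe_toContinuousLinearMap]

/-- The restriction `φ ↦ φ ∘ f` along an injection of the basis labels. -/
def restrict (f : X ↪ Y) : L2 Y →L[ℂ] L2 X := (embed f).adjoint

@[simp]
theorem restrict_apply (f : X ↪ Y) (φ : L2 Y) (x : X) : restrict f φ x = φ (f x) := by
  rw [← inner_ket_left, restrict, ContinuousLinearMap.adjoint_inner_right, embed_ket,
    inner_ket_left]

theorem restrict_ket (f : X ↪ Y) (x : X) : restrict f (ket (f x)) = ket x := by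
  classical
  ext y
  simp [ket_apply]

theorem restrict_ket_of_notMem (f : X ↪ Y) {y : Y} (h : y ∉ Set.range f) :
    restrict f (ket y) = 0 := by
  classical
  ext x
  simp only [restrict_apply, ket_apply, lp.coeFn_zero, Pi.zero_apply, ite_eq_right_iff,
    one_ne_zero]
  exact fun h' => h ⟨x, h'⟩

theorem embed_apply_eq_inner (f : X ↪ Y) (φ : L2 X) (y : Y) :
    embed f φ y = inner ℂ (restrict f (ket y)) φ := by
  rw [← inner_ket_left, restrict, ContinuousLinearMap.adjoint_inner_left]

@[simp]
theorem embed_apply (f : X ↪ Y) (φ : L2 X) (x : X) : embed f φ (f x) = φ x := by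
  rw [embed_apply_eq_inner, restrict_ket, inner_ket_left]

theorem embed_apply_of_notMem (f : X ↪ Y) (φ : L2 X) {y : Y} (h : y ∉ Set.range f) :
    embed f φ y = 0 := by
  rw [embed_apply_eq_inner, restrict_ket_of_notMem f h, inner_zero_left]

theorem embed_trans (f : X ↪ Y) (g : Y ↪ Z) (φ : L2 X) :
    embed g (embed f φ) = embed (f.trans g) φ := by
  suffices h : (embed g) ∘L (embed f) = embed (f.trans g) from DFunLike.congr_fun h φ
  exact clm_ext_ket fun x => by simp

theorem relabel_eq_embed (e : X ≃ Y) (φ : L2 X) : relabel e φ = embed e.toEmbedding φ := by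
  suffices h : (relabel e : L2 X →L[ℂ] L2 Y) = embed e.toEmbedding from DFunLike.congr_fun h φ
  refine clm_ext_ket fun x => ?_
  rw [embed_ket]
  exact relabel_ket e x

theorem conjRelabel_apply (e : X ≃ Y) (T : L2 X →L[ℂ] L2 X) (φ : L2 Y) (y : Y) :
    conjRelabel e T φ y = T (relabel e.symm φ) (e.symm y) := rfl

theorem conjRelabel_ket (e : X ≃ Y) (T : L2 X →L[ℂ] L2 X) (y : Y) :
    conjRelabel e T (ket y) = relabel e (T (ket (e.symm y))) := by
  change relabel e (T (relabel e.symm (ket y))) = _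
  rw [relabel_ket]

end Ket

/-- The entrywise image of a configuration under an injection that preserves the empty state. -/
def mapConfig {A : Type u} {B : Type v} [Zero A] [Zero B] (n : ℕ) (f : A → B)
    (hf : Function.Injective f) (h0 : f 0 = 0) :
    Config n A ↪ Config n B :=
  ⟨Finsupp.mapRange f h0, Finsupp.mapRange_injective f h0 hf⟩

/-! ### Tensor products of local isometries on basis vectors -/

namespace LocalIsometry

variable {A : Type u} {B : Type v} [Fintype A] [Zero A] [DecidableEq A]
  [Fintype B] [Zero B] [DecidableEq B] {n : ℕ}

/-- A `finprod` with infinite support takes the default value 1, so this finiteness is what allows a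
single vanishing factor to annihilate an amplitude. -/
theorem finite_mulSupport (V : LocalIsometry A B) (c : Config n A) (d : Config n B) :
    (Function.mulSupport fun x => V.mat (d x) (c x)).Finite := by
  refine (c.support ∪ d.support).finite_toSet.subset fun y hy => ?_
  by_contra hy'
  simp only [Finset.coe_union, Set.mem_union, Finset.mem_coe, Finsupp.mem_support_iff,
    not_or, not_not] at hy'
  exact hy (by simp [hy'.1, hy'.2, V.mat_zero])

/-- The quiescent isometry `|a⟩ ↦ |f a⟩` induced by an injection `f` with `f 0 = 0`. -/
def ofInjective (f : A → B) (hf : Function.Injective f) (h0 : f 0 = 0) : LocalIsometry A B where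
  mat := Matrix.of fun b a => if b = f a then 1 else 0
  isometry := by
    ext a a'
    simp [Matrix.mul_apply, Matrix.one_apply, hf.eq_iff, eq_comm]
  quiescent := by
    ext b
    simp [h0, Pi.single_apply]

theorem tensor_ofInjective (f : A → B) (hf : Function.Injective f) (h0 : f 0 = 0) :
    (ofInjective f hf h0).tensor n = embed (mapConfig n f hf h0) := by
  classical
  refine clm_ext_ket fun c => ?_
  ext d
  rw [tensor_ket, embed_ket, ket_apply]
  split_ifs with h
  · subst h
    exact finprod_eq_one_of_forall_eq_one fun x => by simp [ofInjective, mapConfig]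
  · obtain ⟨x, hx⟩ : ∃ x, d x ≠ f (c x) := by
      by_contra! h'
      exact h (Finsupp.ext h')
    exact finprod_eq_zero _ x (by simp [ofInjective, hx]) (finite_mulSupport _ c d)

end LocalIsometry

/-! ### Steps of a PQCA as tensor products -/

section Hypercubes

variable {n : ℕ} {A : Type u} [Zero A]

theorem shift_zero : shift (0 : Grid n) = Equiv.refl (Config n A) := by
  ext c x
  simp [shift_apply]

/-- The hypercubes of `2ⁿ` cells on which a PQCA acts at time `t`. -/
def hypercubes (t : ℕ) : Config n A ≃ Config n (Block n 2 A) :=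
  (shift fun _ => if Even t then 0 else 1).trans (group 2)

theorem hypercubes_of_even {t : ℕ} (ht : Even t) :
    (hypercubes t : Config n A ≃ Config n (Block n 2 A)) = group 2 := by
  simp only [hypercubes, ht, if_true]
  exact congrArg (fun e => Equiv.trans e (group 2)) shift_zero

theorem hypercubes_of_odd {t : ℕ} (ht : ¬ Even t) :
    (hypercubes t : Config n A ≃ Config n (Block n 2 A)) =
      (shift fun _ => 1).trans (group 2) := by
  simp only [hypercubes, ht, if_false]

/-- Conjugating `J` by `τ` only changes how cells are grouped, so steps of both parities take the
same form. -/
theorem ScatteringUnitary.step_eq [Fintype A] [DecidableEq A] (U : ScatteringUnitary n A) (t : ℕ) :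
    U.step t = conjRelabel (hypercubes t).symm (U.toLocalIsometry.tensor n) := by
  by_cases ht : Even t
  · rw [hypercubes_of_even ht, step, if_pos ht, J]
  · rw [hypercubes_of_odd ht, step, if_neg ht]
    rfl

end Hypercubes

/-! ### Local isometries acting through an encoding -/

/-- The encoding of configurations that encodes each of the blocks `blk` by `i` into the hypercubes of
time `t`. -/
def encoding {P : Type w} {C : Type u} [Zero C] {B : Type v} [Zero B] {n : ℕ}
    (blk : P ≃ Config n C) (i : C → Block n 2 B)
    (hi : Function.Injective i) (hi0 : i 0 = 0) (t : ℕ) : P ↪ Config n B :=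
  (blk.toEmbedding.trans (mapConfig n i hi hi0)).trans (hypercubes t).symm.toEmbedding

namespace LocalIsometry

variable {C : Type u} {D : Type v} [Fintype C] [Zero C] [DecidableEq C]
  [Fintype D] [Zero D] [DecidableEq D] {n : ℕ}

/-- `V` acts as `W` does, once its inputs are encoded by `i` and its outputs by `j`. -/
def ActsAs (V : LocalIsometry D D) (W : LocalIsometry C C) (i j : C → D) : Prop :=
  (∀ w w', V.mat (j w') (i w) = W.mat w' w) ∧ ∀ y w, y ∉ Set.range j → V.mat y (i w) = 0

/-- Amplitudes are products over cells: on codewords of `j` the factors agree one by one, and a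
single letter that is not a codeword makes both sides vanish. -/
theorem ActsAs.tensor_comp_embed {V : LocalIsometry D D} {W : LocalIsometry C C} {i j : C → D}
    (h : V.ActsAs W i j) (hi : Function.Injective i) (hi0 : i 0 = 0)
    (hj : Function.Injective j) (hj0 : j 0 = 0) :
    V.tensor n ∘L embed (mapConfig n i hi hi0) = embed (mapConfig n j hj hj0) ∘L W.tensor n := by
  classical
  refine clm_ext_ket fun c => ?_
  ext d
  simp only [ContinuousLinearMap.comp_apply, embed_ket, tensor_ket]
  by_cases hd : ∀ x, d x ∈ Set.range j
  · choose e he using hd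
    have hfin : (Function.support e).Finite := by
      refine d.support.finite_toSet.subset fun x hx => ?_
      simp only [Finset.mem_coe, Finsupp.mem_support_iff, ← he]
      rw [← hj0]
      exact fun h' => hx (hj h')
    obtain rfl : d = mapConfig n j hj hj0 (Finsupp.ofSupportFinite e hfin) :=
      Finsupp.ext fun x => (he x).symm
    rw [embed_apply, tensor_ket]
    exact finprod_congr fun x => h.1 _ _
  · push Not at hd
    obtain ⟨x, hx⟩ := hd
    rw [embed_apply_of_notMem]
    · exact finprod_eq_zero _ x (h.2 _ _ hx) (finite_mulSupport _ _ _)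
    · rintro ⟨e, rfl⟩
      exact hx ⟨e x, rfl⟩

/-- The ranges of `i` and `j` have the same finite cardinality, so `i w ↦ j w` extends to a
permutation `π` of `D`. Then `V` is `W` on the codewords of `i` and the identity on the other
letters, followed by `π`. -/
theorem exists_actsAs (W : LocalIsometry C C) (i j : C → D) (hi : Function.Injective i)
    (hi0 : i 0 = 0) (hj : Function.Injective j) (hj0 : j 0 = 0) :
    ∃ V : LocalIsometry D D, V.ActsAs W i j := by
  classical
  let σ : C ⊕ ((Set.range i)ᶜ : Set D) ≃ D :=
    ((Equiv.ofInjective i hi).sumCongr (Equiv.refl _)).trans (Equiv.Set.sumCompl (Set.range i))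
  have hσ : ∀ w, σ.symm (i w) = Sum.inl w := fun w => by
    rw [Equiv.symm_apply_eq]
    simp [σ]
  let π : Equiv.Perm D := Equiv.extendSubtype (p := (· ∈ Set.range i)) (q := (· ∈ Set.range j))
    ((Equiv.ofInjective i hi).symm.trans (Equiv.ofInjective j hj))
  have hπ : ∀ w, π (i w) = j w := fun w => by
    rw [Equiv.extendSubtype_apply_of_mem _ _ ⟨w, rfl⟩]
    simp
  have hπ' : ∀ w, π.symm (j w) = i w := fun w => by rw [Equiv.symm_apply_eq, hπ]
  let M : Matrix (C ⊕ ((Set.range i)ᶜ : Set D)) (C ⊕ ((Set.range i)ᶜ : Set D)) ℂ :=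
    Matrix.fromBlocks W.mat 0 0 1
  have hM : Mᴴ * M = 1 := by
    simp [M, Matrix.fromBlocks_conjTranspose, Matrix.fromBlocks_multiply, W.isometry]
  let V : Matrix D D ℂ := M.submatrix (π.symm.trans σ.symm) σ.symm
  have hV : ∀ w w', V (j w') (i w) = W.mat w' w := fun w w' => by
    simp [V, hπ', hσ, M]
  have hV0 : ∀ y w, y ∉ Set.range j → V y (i w) = 0 := fun y w hy => by
    have h1 : π.symm y ∉ Set.range i := by
      rintro ⟨w', hw'⟩
      exact hy ⟨w', by rw [← hπ, hw', Equiv.apply_symm_apply]⟩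
    obtain ⟨a, ha⟩ : ∃ a, σ.symm (π.symm y) = Sum.inr a := by
      rcases h2 : σ.symm (π.symm y) with a | a
      · rw [Equiv.symm_apply_eq] at h2
        exact absurd ⟨a, by simp [h2, σ]⟩ h1
      · exact ⟨a, rfl⟩
    simp [V, ha, hσ, M]
  refine ⟨⟨V, ?_, ?_⟩, hV, hV0⟩
  · simp only [V, Matrix.conjTranspose_submatrix, Matrix.submatrix_mul_equiv, hM,
      Matrix.submatrix_one_equiv]
  · ext y
    simp only [Matrix.mulVec_single_one, Matrix.col_apply]
    by_cases hy : y ∈ Set.range j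
    · obtain ⟨w, rfl⟩ := hy
      rw [show V (j w) 0 = V (j w) (i 0) by rw [hi0], hV, W.mat_zero, ← hj0, Pi.single_apply]
      simp [hj.eq_iff]
    · rw [show V y 0 = V y (i 0) by rw [hi0], hV0 _ _ hy, Pi.single_apply, if_neg]
      rintro rfl
      exact hy ⟨0, hj0⟩

/-- A scattering unitary from a quiescent isometry of the space of one hypercube. -/
def toScatteringUnitary {B : Type v} [Fintype B] [Zero B] [DecidableEq B]
    (V : LocalIsometry (Block n 2 B) (Block n 2 B)) : ScatteringUnitary n B where
  mat := V.mat
  unitary := Matrix.mem_unitaryGroup_iff'.2 V.isometry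
  quiescent := V.quiescent

theorem ActsAs.step_comp_embed {P : Type w} {B : Type v} [Fintype B] [Zero B] [DecidableEq B]
    {V : LocalIsometry (Block n 2 B) (Block n 2 B)} {W : LocalIsometry C C}
    {i j : C → Block n 2 B} (h : V.ActsAs W i j) (hi : Function.Injective i) (hi0 : i 0 = 0)
    (hj : Function.Injective j) (hj0 : j 0 = 0) (blk : P ≃ Config n C) (t : ℕ) :
    V.toScatteringUnitary.step t ∘L embed (encoding blk i hi hi0 t) =
      embed (encoding blk j hj hj0 t) ∘L conjRelabel blk.symm (W.tensor n) := by
  refine clm_ext_ket fun p => ?_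
  have key := DFunLike.congr_fun (h.tensor_comp_embed (n := n) hi hi0 hj hj0) (ket (blk p))
  simp only [ContinuousLinearMap.comp_apply, embed_ket] at key
  simp only [ContinuousLinearMap.comp_apply, embed_ket, ScatteringUnitary.step_eq,
    conjRelabel_ket, relabel_eq_embed, Equiv.symm_symm]
  have h1 : hypercubes t (encoding blk i hi hi0 t p) = mapConfig n i hi hi0 (blk p) := by
    simp [encoding]
  have h2 : V.toScatteringUnitary.toLocalIsometry = V := rfl
  rw [h1, h2, key, embed_trans, embed_trans]
  congr 2
  ext1 c
  simp [encoding]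

end LocalIsometry

/-! ### Time-dependent scattering unitaries

Each cell carries one track for each time step modulo `k`; the scattering unitary applies the `t`-th
isometry to the `t`-th track while moving its content to the next track. -/

section Tracks

variable {n k : ℕ} {D : Type u} [Zero D]

/-- The hypercube whose track `t` holds `w` and whose other tracks are empty. -/
def track (t : Fin k) (w : Block n 2 D) : Block n 2 (Fin k → D) :=
  fun o t' => if t' = t then w o else 0

theorem track_injective (t : Fin k) :
    Function.Injective (track t : Block n 2 D → Block n 2 (Fin k → D)) := by
  intro w w' h
  ext o
  simpa [track] using congrFun (congrFun h o) t

@[simp]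
theorem track_zero (t : Fin k) : track t (0 : Block n 2 D) = 0 := by
  ext o t'
  simp [track]

/-- The content of the hypercube `w` on track `t`. -/
def onTrack {n k : ℕ} {D : Type u} (w : Block n 2 (Fin k → D))
    (t : Fin k) : Block n 2 D := fun o => w o t

theorem onTrack_track (t : Fin k) (w : Block n 2 D) (t' : Fin k) :
    onTrack (track t w) t' = if t' = t then w else 0 := by
  ext o
  by_cases h : t' = t <;> simp [onTrack, track, h]

theorem onTrack_ext {n k : ℕ} {D : Type u} {w w' : Block n 2 (Fin k → D)}
    (h : ∀ t, onTrack w t = onTrack w' t) :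
    w = w' := by
  ext o t
  exact congrFun (h t) o

variable [Fintype D] [DecidableEq D] [NeZero k]

/-- The tensor product of isometries acting on tracks, followed by the cyclic permutation of the
tracks. -/
def multiplex (V : Fin k → LocalIsometry (Block n 2 D) (Block n 2 D)) :
    LocalIsometry (Block n 2 (Fin k → D)) (Block n 2 (Fin k → D)) where
  mat := Matrix.of fun w' w => ∏ t, (V t).mat (onTrack w' (t + 1)) (onTrack w t)
  isometry := by
    ext w w'
    have h1 : ∀ t, ∑ b, star ((V t).mat b (onTrack w t)) * (V t).mat b (onTrack w' t) =
        if onTrack w t = onTrack w' t then 1 else 0 := by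
      intro t
      have := congrFun (congrFun (V t).isometry (onTrack w t)) (onTrack w' t)
      simpa [Matrix.mul_apply, Matrix.one_apply] using this
    -- The outputs are indexed by the track they come from, so the sum over words becomes a product
    -- of sums over tracks.
    let e : Block n 2 (Fin k → D) ≃ (Fin k → Block n 2 D) :=
      { toFun := fun w t => onTrack w (t + 1)
        invFun := fun f o t => f (t - 1) o
        left_inv := fun w => by ext o t; simp [onTrack]
        right_inv := fun f => by ext t o; simp [onTrack] }
    simp only [Matrix.mul_apply, Matrix.conjTranspose_apply, Matrix.of_apply, star_prod,
      ← Finset.prod_mul_distrib]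
    refine (Fintype.sum_equiv e _ (fun f => ∏ t, star ((V t).mat (f t) (onTrack w t)) *
      (V t).mat (f t) (onTrack w' t)) fun w => rfl).trans ?_
    rw [← Fintype.prod_sum fun t b => star ((V t).mat b (onTrack w t)) * (V t).mat b (onTrack w' t),
      Finset.prod_congr rfl fun t _ => h1 t, Matrix.one_apply]
    split_ifs with h
    · simp [h]
    · obtain ⟨t, ht⟩ : ∃ t, onTrack w t ≠ onTrack w' t := by
        by_contra! h'
        exact h (onTrack_ext h')
      exact Finset.prod_eq_zero (Finset.mem_univ t) (if_neg ht)
  quiescent := by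
    ext w
    simp only [Matrix.mulVec_single_one, Matrix.col_apply, Matrix.of_apply, Pi.single_apply]
    have h0 : ∀ t : Fin k, onTrack (0 : Block n 2 (Fin k → D)) t = 0 := fun t => rfl
    simp only [h0, LocalIsometry.mat_zero]
    split_ifs with h
    · simp [h, h0]
    · obtain ⟨t, ht⟩ : ∃ t, onTrack w t ≠ 0 := by
        by_contra! h'
        exact h (onTrack_ext h')
      exact Finset.prod_eq_zero (Finset.mem_univ (t - 1)) (if_neg (by simpa using ht))

/-- By quiescence, empty tracks stay empty. If only track `t` carries data, then only `V t` has an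
effect, and the data lands on track `t + 1`. -/
theorem multiplex_actsAs {C : Type v} [Fintype C] [Zero C] [DecidableEq C]
    (V : Fin k → LocalIsometry (Block n 2 D) (Block n 2 D)) (W : LocalIsometry C C)
    (i j : C → Block n 2 D) (t : Fin k) (h : (V t).ActsAs W i j) :
    (multiplex V).ActsAs W (track t ∘ i) (track (t + 1) ∘ j) := by
  have key : ∀ y w, (multiplex V).mat y (track t w) =
      if y = track (t + 1) (onTrack y (t + 1)) then (V t).mat (onTrack y (t + 1)) w else 0 := by
    intro y w
    simp only [multiplex, Matrix.of_apply, onTrack_track]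
    split_ifs with hy
    · rw [Finset.prod_eq_single t]
      · simp
      · intro t' _ ht'
        rw [if_neg ht', LocalIsometry.mat_zero, if_pos]
        rw [hy, onTrack_track, if_neg (by simpa using ht')]
      · simp
    · obtain ⟨t', ht'⟩ : ∃ t', onTrack y t' ≠ onTrack (track (t + 1) (onTrack y (t + 1))) t' := by
        by_contra! h'
        exact hy (onTrack_ext h')
      rw [onTrack_track] at ht'
      have hne : t' ≠ t + 1 := by
        rintro rfl
        simp at ht'
      rw [if_neg hne] at ht'
      refine Finset.prod_eq_zero (Finset.mem_univ (t' - 1)) ?_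
      rw [if_neg (by rwa [sub_eq_iff_eq_add]), LocalIsometry.mat_zero, if_neg (by simpa using ht')]
  constructor
  · intro w w'
    simp [key, onTrack_track, h.1]
  · intro y w hy
    simp only [Function.comp_apply, key]
    split_ifs with hy'
    · refine h.2 _ _ ?_
      rintro ⟨v, hv⟩
      exact hy ⟨v, by rw [Function.comp_apply, hv, ← hy']⟩
    · rfl

end Tracks

/-! ### Distributing a supercell over the cells of a hypercube -/

section Split

variable {n L : ℕ} {Q : Type u} [Zero Q]

/-- The hypercube of time `0` which stores the letter `p` of the supercell `w` in its last cell,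
except that the coordinates `i` with `p i < c i` are moved backwards by one. -/
def split (c : Fin n → Fin L) (w : Block n L Q) : Block n 2 (Block n L Q) :=
  fun o p => if o = (fun i => if p i < c i then 0 else 1) then w p else 0

/-- The hypercube of time `1` obtained from `split c`, given the window of cells offset by `c`. -/
def splitOdd [NeZero L] (c : Fin n → Fin L) (w : Block n L Q) : Block n 2 (Block n L Q) :=
  fun o p => if o = (fun i => if p i < c i then 1 else 0) then w (p - c) else 0

theorem split_injective (c : Fin n → Fin L) :
    Function.Injective (split c : Block n L Q → Block n 2 (Block n L Q)) := by
  intro w w' h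
  ext p
  simpa [split] using congrFun (congrFun h fun i => if p i < c i then 0 else 1) p

theorem split_zero (c : Fin n → Fin L) : split c (0 : Block n L Q) = 0 := by
  ext o p
  simp [split]

variable [NeZero L]

theorem splitOdd_injective (c : Fin n → Fin L) :
    Function.Injective (splitOdd c : Block n L Q → Block n 2 (Block n L Q)) := by
  intro w w' h
  ext p
  simpa [splitOdd] using
    congrFun (congrFun h fun i => if (p + c) i < c i then 1 else 0) (p + c)

theorem splitOdd_zero (c : Fin n → Fin L) : splitOdd c (0 : Block n L Q) = 0 := by
  ext o p
  simp [splitOdd]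

/-- An offset within a supercell, as a vector of the grid. -/
def toGrid (c : Fin n → Fin L) : Grid n := fun i => ((c i : ℕ) : ℤ)

/-- Grouping cells into supercells after a translation by `c`. -/
def groupAt (c : Fin n → Fin L) : Config n Q ≃ Config n (Block n L Q) :=
  (shift (toGrid c)).trans (group L)

theorem fin_two_sub (a : ℤ) (o : Fin 2) :
    (2 * a + ((o : ℕ) : ℤ) + 1) / 2 = a + ((o : ℕ) : ℤ) ∧
      (2 * a + ((o : ℕ) : ℤ) + 1) % 2 = 1 - ((o : ℕ) : ℤ) := by
  have := o.2
  omega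

/-- The corner `o` of the odd hypercube `x` is the cell `2x + o + 1`, which lies in the even
hypercube `x + o`. The window `L x + c + {0, …, L-1}ⁿ` takes its letters with `p i < c i` from the
next supercell in direction `i`, and `split c` puts these in corners with coordinate 0, the side
facing the odd hypercube `x`. One placement of letters can thus be read as supercells at even times
and as windows at odd times. -/
theorem encoding_split_eq {k : ℕ} (c : Fin n → Fin L) (τ : Fin k) {t t' : ℕ} (ht : Even t)
    (ht' : ¬ Even t') (h1 h2 h3 h4) :
    encoding (group L : Config n Q ≃ _) (track τ ∘ split c) h1 h2 t =
      encoding (groupAt c) (track τ ∘ splitOdd c) h3 h4 t' := by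
  ext1 q
  simp only [encoding, Function.Embedding.trans_apply, Equiv.coe_toEmbedding]
  rw [Equiv.eq_symm_apply, hypercubes_of_even ht, hypercubes_of_odd ht']
  ext x o τ' p
  change track τ (split c (group L q (supercellOf 2 (cellAt 2 x o + fun _ => 1))))
      (offsetOf 2 (cellAt 2 x o + fun _ => 1)) τ' p =
    track τ (splitOdd c (group L (shift (toGrid c) q) x)) o τ' p
  simp only [track]
  split_ifs
  swap
  · rfl
  simp only [split, splitOdd]
  have hiff : (offsetOf 2 (cellAt 2 x o + fun _ => 1) = fun i => if p i < c i then 0 else 1) ↔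
      o = fun i => if p i < c i then 1 else 0 := by
    rw [funext_iff, funext_iff]
    refine forall_congr' fun i => ?_
    have h := (fin_two_sub (x i) (o i)).2
    have ho := (o i).2
    simp only [offsetOf, cellAt, Pi.add_apply, Fin.ext_iff]
    push_cast
    rw [h]
    split_ifs <;> simp <;> omega
  rw [if_congr hiff rfl rfl]
  split_ifs with ho
  swap
  · rfl
  change q (cellAt L (supercellOf 2 (cellAt 2 x o + fun _ => 1)) p) =
    q (cellAt L x (p - c) + toGrid c)
  congr 1
  funext i
  have h := (fin_two_sub (x i) (o i)).1
  simp only [cellAt, supercellOf, Pi.add_apply, toGrid, Pi.sub_apply]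
  push_cast
  rw [h]
  have hoi := congrFun ho i
  have hp := (p i).2
  have hc := (c i).2
  -- Subtraction in `Fin L` wraps around exactly when `p i < c i`. The extra `L` accounts for the
  -- letter coming from the next supercell.
  rcases lt_or_ge (p i) (c i) with hlt | hge
  · rw [Fin.coe_sub_iff_lt.2 hlt, hoi, if_pos hlt]
    have := Fin.lt_def.1 hlt
    push_cast [show (c i : ℕ) ≤ L + p i by omega]
    simp
    ring
  · rw [Fin.coe_sub_iff_le.2 hge, hoi, if_neg (not_lt.2 hge)]
    push_cast [Fin.le_def.1 hge]
    simp
    ring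

end Split

/-! ### Circuits of translated block gates -/

section Circuit

variable {n L : ℕ} [NeZero L] {Q : Type u} [Fintype Q] [Zero Q] [DecidableEq Q]

/-- The operator that applies the gate `W` to each of the windows of cells `L x + c + {0, …,
L-1}ⁿ`. -/
def gateAt (c : Fin n → Fin L) (W : LocalIsometry (Block n L Q) (Block n L Q)) : Op n Q :=
  conjRelabel (groupAt c).symm (W.tensor n)

/-- The operator of the first `a` gates of a sequence. -/
def circuit (c : ℕ → Fin n → Fin L) (W : ℕ → LocalIsometry (Block n L Q) (Block n L Q)) :
    ℕ → Op n Q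
  | 0 => ContinuousLinearMap.id ℂ _
  | a + 1 => gateAt (c a) (W a) ∘L circuit c W a

theorem LocalIsometry.tensor_id (A : Type u) [Fintype A] [Zero A] [DecidableEq A] :
    (LocalIsometry.ofInjective (id : A → A) Function.injective_id rfl).tensor n =
      ContinuousLinearMap.id ℂ _ := by
  rw [LocalIsometry.tensor_ofInjective]
  refine clm_ext_ket fun c => ?_
  rw [embed_ket]
  exact congrArg ket (Finsupp.ext fun x => rfl)

theorem conjRelabel_id {X Y : Type*} (e : X ≃ Y) :
    conjRelabel e (ContinuousLinearMap.id ℂ (L2 X)) = ContinuousLinearMap.id ℂ _ := by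
  refine clm_ext_ket fun y => ?_
  rw [conjRelabel_ket]
  simp [relabel_ket]

/-- Every circuit of translated block gates is run by a PQCA. -/
theorem exists_evolution_eq_circuit (c : ℕ → Fin n → Fin L)
    (W : ℕ → LocalIsometry (Block n L Q) (Block n L Q)) (m : ℕ) (hc : c m = 0) :
    ∃ (k : ℕ) (_ : NeZero k) (U : ScatteringUnitary n (Fin k → Block n L Q)),
      k = 2 * (m + 1) ∧ ∀ h1 h2,
        U.evolution k ∘L embed (encoding (group L) (track 0 ∘ split 0) h1 h2 0) =
          embed (encoding (group L) (track 0 ∘ split 0) h1 h2 0) ∘L circuit c W (m + 1) := by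
  have hi : ∀ (k : ℕ) (t : Fin k) (d : Fin n → Fin L),
      Function.Injective (track t ∘ split d : Block n L Q → _) :=
    fun k t d => (track_injective t).comp (split_injective d)
  have hi0 : ∀ (k : ℕ) (t : Fin k) (d : Fin n → Fin L),
      (track t ∘ split d : Block n L Q → _) 0 = 0 := fun k t d => by simp [split_zero]
  have hj : ∀ (k : ℕ) (t : Fin k) (d : Fin n → Fin L),
      Function.Injective (track t ∘ splitOdd d : Block n L Q → _) :=
    fun k t d => (track_injective t).comp (splitOdd_injective d)
  have hj0 : ∀ (k : ℕ) (t : Fin k) (d : Fin n → Fin L),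
      (track t ∘ splitOdd d : Block n L Q → _) 0 = 0 := fun k t d => by simp [splitOdd_zero]
  -- `d a` is the offset of the data just before the gate `a` is prepared
  let d : ℕ → Fin n → Fin L := fun a => Nat.casesOn a 0 c
  let I : LocalIsometry (Block n L Q) (Block n L Q) :=
    LocalIsometry.ofInjective id Function.injective_id rfl
  have hev : ∀ a, ∃ V : LocalIsometry (Block n 2 (Block n L Q)) (Block n 2 (Block n L Q)),
      V.ActsAs I (split (d a)) (split (d (a + 1))) := fun a =>
    LocalIsometry.exists_actsAs _ _ _ (split_injective _) (split_zero _) (split_injective _)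
      (split_zero _)
  have hodd : ∀ a, ∃ V : LocalIsometry (Block n 2 (Block n L Q)) (Block n 2 (Block n L Q)),
      V.ActsAs (W a) (splitOdd (c a)) (splitOdd (c a)) := fun a =>
    LocalIsometry.exists_actsAs _ _ _ (splitOdd_injective _) (splitOdd_zero _)
      (splitOdd_injective _) (splitOdd_zero _)
  choose Ve hVe using hev
  choose Vo hVo using hodd
  refine ⟨2 * (m + 1), ⟨by omega⟩, ?_⟩
  have : NeZero (2 * (m + 1)) := ⟨by omega⟩
  -- Track `2a` moves the letters from the placement for `d a` to the one for `c a`; track `2a + 1`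
  -- applies the gate `W a`.
  let V : Fin (2 * (m + 1)) → LocalIsometry (Block n 2 (Block n L Q)) (Block n 2 (Block n L Q)) :=
    fun t => if Even (t : ℕ) then Ve (t / 2) else Vo (t / 2)
  let U := (multiplex V).toScatteringUnitary
  refine ⟨U, rfl, fun h1 h2 => ?_⟩
  have main : ∀ a ≤ m + 1, U.evolution (2 * a) ∘L
      embed (encoding (group L) (track 0 ∘ split 0) h1 h2 0) =
        embed (encoding (group L) (track (Fin.ofNat _ (2 * a)) ∘ split (d a))
          (hi _ _ _) (hi0 _ _ _) 0) ∘L circuit c W a := by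
    intro a
    induction a with
    | zero => intro _; rfl
    | succ a ih =>
      intro ha
      specialize ih (by omega)
      have e0 : Even (2 * a) := even_two_mul a
      have o1 : ¬ Even (2 * a + 1) := by simp
      have henc : ∀ (τ : Fin (2 * (m + 1))) (f : Fin n → Fin L),
          encoding (group L : Config n Q ≃ _) (track τ ∘ split f) (hi _ _ _) (hi0 _ _ _) 0 =
          encoding (group L) (track τ ∘ split f) (hi _ _ _) (hi0 _ _ _) (2 * a) := by
        intro τ f
        simp only [encoding, hypercubes_of_even e0, hypercubes_of_even Even.zero]
      have v0 : ((Fin.ofNat (2 * (m + 1)) (2 * a) : Fin _) : ℕ) = 2 * a :=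
        Nat.mod_eq_of_lt (by omega)
      have v1 : ((Fin.ofNat (2 * (m + 1)) (2 * a + 1) : Fin _) : ℕ) = 2 * a + 1 :=
        Nat.mod_eq_of_lt (by omega)
      have s0 : (Fin.ofNat (2 * (m + 1)) (2 * a) : Fin _) + 1 = Fin.ofNat _ (2 * a + 1) := by
        apply Fin.ext
        simp [Fin.val_add]
      have s1 : (Fin.ofNat (2 * (m + 1)) (2 * a + 1) : Fin _) + 1 = Fin.ofNat _ (2 * (a + 1)) := by
        apply Fin.ext
        simp [Fin.val_add]
        congr 1
      have a0 : (V (Fin.ofNat _ (2 * a))).ActsAs I (split (d a)) (split (d (a + 1))) := by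
        simp only [V, v0, e0, if_true]
        rw [Nat.mul_div_cancel_left a two_pos]
        exact hVe a
      have a1 : (V (Fin.ofNat _ (2 * a + 1))).ActsAs (W a) (splitOdd (c a)) (splitOdd (c a)) := by
        simp only [V, v1, o1, if_false]
        rw [show (2 * a + 1) / 2 = a by omega]
        exact hVo a
      have b0 := multiplex_actsAs V _ _ _ _ a0
      have b1 := multiplex_actsAs V _ _ _ _ a1
      rw [s0] at b0
      rw [s1] at b1
      have c0 := b0.step_comp_embed (hi _ _ _) (hi0 _ _ _) (hi _ _ _) (hi0 _ _ _)
        (group L : Config n Q ≃ _) (2 * a)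
      have c1 := b1.step_comp_embed (hj _ _ _) (hj0 _ _ _) (hj _ _ _) (hj0 _ _ _)
        (groupAt (c a) : Config n Q ≃ _) (2 * a + 1)
      rw [LocalIsometry.tensor_id, conjRelabel_id] at c0
      rw [← encoding_split_eq (c a) _ e0 o1 (hi _ _ _) (hi0 _ _ _),
        ← encoding_split_eq (c a) _ e0 o1 (hi _ _ _) (hi0 _ _ _)] at c1
      change U.step (2 * a + 1) ∘L (U.step (2 * a) ∘L U.evolution (2 * a)) ∘L _ = _
      change U.step (2 * a) ∘L _ = _ at c0
      change U.step (2 * a + 1) ∘L _ = _ at c1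
      rw [ContinuousLinearMap.comp_assoc (U.step (2 * a)), ih, henc,
        ← ContinuousLinearMap.comp_assoc (U.step (2 * a)), c0, ContinuousLinearMap.comp_id, ← ContinuousLinearMap.comp_assoc]
      change (U.step (2 * a + 1) ∘L embed (encoding (group L) (track _ ∘ split (c a)) _ _ (2 * a)))
        ∘L _ = _
      rw [c1, henc]
      rfl
  have hm := main (m + 1) le_rfl
  rw [hm]
  -- The last offset is 0 and the clock is back at track 0, so the final encoding is the initial
  -- one.
  have hd : d (m + 1) = 0 := hc
  have ht : (Fin.ofNat (2 * (m + 1)) (2 * (m + 1)) : Fin _) = 0 := by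
    apply Fin.ext
    simp
  simp only [hd, ht]

end Circuit

/-! ### Causality in the Heisenberg picture -/

section Reduced

variable {n : ℕ} {A : Type u} [Zero A]

theorem glue_of_mem {S : Finset (Grid n)} (a : S → A) (e : Config n A) {x : Grid n} (h : x ∈ S) :
    glue S a e x = a ⟨x, h⟩ := by
  simp [glue, h]

theorem glue_of_notMem {S : Finset (Grid n)} (a : S → A) (e : Config n A) {x : Grid n}
    (h : x ∉ S) : glue S a e x = e x := by
  simp [glue, h]

/-- The configurations that coincide with `a` on `S`, seen as configurations of the complement. -/
def glueEmb (S : Finset (Grid n)) (a : S → A) :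
    {e : Config n A // ∀ x ∈ S, e x = 0} ↪ Config n A where
  toFun e := glue S a e.1
  inj' e e' h := by
    apply Subtype.ext
    ext x
    by_cases hx : x ∈ S
    · rw [e.2 x hx, e'.2 x hx]
    · have := DFunLike.congr_fun h x
      simpa [glue_of_notMem _ _ hx] using this

theorem glueEmb_apply (S : Finset (Grid n)) (a : S → A) (e) : glueEmb S a e = glue S a e.1 := rfl

theorem exists_glueEmb_eq (S : Finset (Grid n)) (c : Config n A) :
    ∃ e, glueEmb S (fun x => c x) e = c ∧ ∀ x ∉ S, e.1 x = c x := by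
  classical
  refine ⟨⟨c.filter (· ∉ S), fun x hx => by simp [hx]⟩, ?_, fun x hx => by simp [hx]⟩
  ext x
  by_cases hx : x ∈ S
  · simp [glueEmb_apply, glue_of_mem _ _ hx]
  · simp [glueEmb_apply, glue_of_notMem _ _ hx, hx]

/-- The partial inner product of `φ` with the basis vector `|a⟩` of the cells `S`. -/
def partialBra (S : Finset (Grid n)) (a : S → A) :
    StateSpace n A →L[ℂ] L2 {e : Config n A // ∀ x ∈ S, e x = 0} :=
  restrict (glueEmb S a)

/-- These are the entries of the partial trace of `|c'⟩⟨c|`, which vanishes unless `c` and `c'`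
agree outside `S`. -/
theorem inner_partialBra_ket [DecidableEq A] (S : Finset (Grid n)) (a b : S → A)
    (c c' : Config n A) [Decidable (∀ x ∉ S, c x = c' x)] :
    inner ℂ (partialBra S b (ket c)) (partialBra S a (ket c')) =
      if (b = fun x : S => c x) ∧ (a = fun x : S => c' x) ∧ ∀ x ∉ S, c x = c' x then 1 else 0 := by
  classical
  rw [partialBra, ← embed_apply_eq_inner]
  obtain ⟨e, he, he'⟩ := exists_glueEmb_eq S c
  by_cases hb : b = fun x : S => c x
  · have hemb := embed_apply (glueEmb S fun x : S => c x) (partialBra S a (ket c')) e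
    rw [he] at hemb
    rw [hb, hemb, partialBra, restrict_apply, ket_apply]
    refine if_congr ?_ rfl rfl
    simp only [true_and]
    constructor
    · intro h
      refine ⟨?_, fun x hx => ?_⟩
      · ext x
        rw [← h, glueEmb_apply, glue_of_mem _ _ x.2]
      · rw [← h, glueEmb_apply, glue_of_notMem _ _ hx, he' x hx]
    · rintro ⟨rfl, h⟩
      ext x
      by_cases hx : x ∈ S
      · rw [glueEmb_apply, glue_of_mem _ _ hx]
      · rw [glueEmb_apply, glue_of_notMem _ _ hx, he' x hx, h x hx]
  · rw [if_neg fun h => hb h.1, embed_apply_of_notMem]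
    rintro ⟨e', rfl⟩
    refine hb ?_
    ext x
    rw [glueEmb_apply, glue_of_mem _ _ x.2]

theorem reduced_rankOne (S : Finset (Grid n)) (ψ : StateSpace n A) (a b : S → A) :
    reduced S (InnerProductSpace.rankOne ℂ ψ ψ) a b =
      inner ℂ (partialBra S b ψ) (partialBra S a ψ) := by
  rw [lp.inner_eq_tsum, reduced]
  refine tsum_congr fun e => ?_
  rw [InnerProductSpace.rankOne_apply, inner_smul_right, inner_ket_left, ← inner_conj_symm,
    inner_ket_left]
  simp [partialBra, glueEmb_apply, mul_comm]

theorem isDensity_rankOne {ψ : StateSpace n A} (hψ : ‖ψ‖ = 1) :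
    IsDensity (InnerProductSpace.rankOne ℂ ψ ψ) := by
  refine ⟨InnerProductSpace.isPositive_rankOne_self ψ, ?_⟩
  have h := lp.hasSum_inner (𝕜 := ℂ) ψ ψ
  rw [inner_self_eq_norm_sq_to_K, hψ, RCLike.ofReal_one, one_pow] at h
  refine h.congr_fun fun c => ?_
  rw [InnerProductSpace.rankOne_apply, inner_smul_right, inner_ket_left, ← inner_conj_symm,
    inner_ket_left, RCLike.inner_apply, mul_comm]

theorem conj_rankOne (G : Op n A) (ψ : StateSpace n A) :
    G ∘L InnerProductSpace.rankOne ℂ ψ ψ ∘L G.adjoint =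
      InnerProductSpace.rankOne ℂ (G ψ) (G ψ) := by
  ext1 φ
  simp [InnerProductSpace.rankOne_apply, ContinuousLinearMap.adjoint_inner_right]

/-- The sesquilinear form `⟨G ψ| (|u⟩⟨v|)ₓ |G φ⟩`. -/
def corr (G : Op n A) (x : Grid n) (u v : A) (ψ φ : StateSpace n A) : ℂ :=
  inner ℂ (partialBra {x} (fun _ => u) (G ψ)) (partialBra {x} (fun _ => v) (G φ))

/-- Causality is applied to the pure states `ψ` and `φ`. It speaks only of density matrices, so both
vectors are first divided by their common norm. -/
theorem CausalWith.corr_congr {N : Finset (Grid n)} {G : Op n A} (hG : CausalWith N G)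
    (x : Grid n) (u v : A) {S : Finset (Grid n)} (hS : N.map (addLeftEmbedding x) = S)
    {ψ φ : StateSpace n A} (hn : ‖ψ‖ = ‖φ‖)
    (h : ∀ a b, inner ℂ (partialBra S b ψ) (partialBra S a ψ) =
      inner ℂ (partialBra S b φ) (partialBra S a φ)) :
    corr G x u v ψ ψ = corr G x u v φ φ := by
  subst hS
  by_cases h0 : ‖ψ‖ = 0
  · have h1 : ψ = 0 := norm_eq_zero.1 h0
    have h2 : φ = 0 := norm_eq_zero.1 (hn.symm.trans h0)
    rw [h1, h2]
  set r : ℂ := ((‖ψ‖⁻¹ : ℝ) : ℂ) with hr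
  have hr0 : r ≠ 0 := by simpa [hr] using h0
  have hψ : ‖r • ψ‖ = 1 := by simp [hr, norm_smul, h0]
  have hφ : ‖r • φ‖ = 1 := by simp [hr, norm_smul, ← hn, h0]
  obtain ⟨f, hf⟩ := hG x
  have h1 := hf _ (isDensity_rankOne hψ)
  have h2 := hf _ (isDensity_rankOne hφ)
  have h3 : reduced (N.map (addLeftEmbedding x)) (InnerProductSpace.rankOne ℂ (r • ψ) (r • ψ)) =
      reduced (N.map (addLeftEmbedding x)) (InnerProductSpace.rankOne ℂ (r • φ) (r • φ)) := by
    ext a b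
    rw [reduced_rankOne, reduced_rankOne]
    simp only [map_smul, inner_smul_left, inner_smul_right, h]
  rw [h3, ← h2, conj_rankOne, conj_rankOne] at h1
  have h4 := congrFun (congrFun h1 fun _ => v) fun _ => u
  rw [reduced_rankOne, reduced_rankOne] at h4
  simp only [map_smul, inner_smul_left, inner_smul_right] at h4
  have hr' : (starRingEnd ℂ) r ≠ 0 := by simpa using hr0
  exact mul_left_cancel₀ hr' (mul_left_cancel₀ hr0 h4)

/-- The matrix `K`, indexed by configurations, is of the form `k ⊗ 1` with `k` acting on `S`. -/
structure IsLocalOn (S : Set (Grid n)) (K : Config n A → Config n A → ℂ) : Prop where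
  eq_zero : ∀ c c' x, x ∉ S → c x ≠ c' x → K c c' = 0
  congr : ∀ c c' d d', (∀ x ∉ S, c x = c' x) → (∀ x ∉ S, d x = d' x) →
    (∀ x ∈ S, c x = d x) → (∀ x ∈ S, c' x = d' x) → K c c' = K d d'

theorem IsLocalOn.mono {S T : Set (Grid n)} {K : Config n A → Config n A → ℂ}
    (h : IsLocalOn S K) (hST : S ⊆ T) : IsLocalOn T K := by
  refine ⟨fun c c' x hx => h.eq_zero c c' x fun hx' => hx (hST hx'), ?_⟩
  intro c c' d d' h1 h2 h3 h4
  by_cases hc : ∀ x ∉ S, c x = c' x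
  · refine h.congr _ _ _ _ hc (fun x hx => ?_) (fun x hx => h3 x (hST hx))
      fun x hx => h4 x (hST hx)
    by_cases hxT : x ∈ T
    · rw [← h3 x hxT, ← h4 x hxT, hc x hx]
    · exact h2 x hxT
  -- The two configurations differ somewhere in `T` outside `S`, where `d` and `d'` differ as well,
  -- so both entries vanish.
  · push Not at hc
    obtain ⟨x, hx, hne⟩ := hc
    have hxT : x ∈ T := by
      by_contra hxT
      exact hne (h1 x hxT)
    rw [h.eq_zero _ _ x hx hne, h.eq_zero d d' x hx (by rwa [← h3 x hxT, ← h4 x hxT])]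

theorem inner_map_ket_add {F : Type*} [NormedAddCommGroup F] [InnerProductSpace ℂ F]
    (S T : StateSpace n A →L[ℂ] F) (c c' : Config n A) {ω : ℂ} (hω : ‖ω‖ = 1) :
    inner ℂ (S (ket c + ω • ket c')) (T (ket c + ω • ket c')) =
      inner ℂ (S (ket c)) (T (ket c)) + inner ℂ (S (ket c')) (T (ket c')) +
        (ω * inner ℂ (S (ket c)) (T (ket c')) +
          (starRingEnd ℂ) ω * inner ℂ (S (ket c')) (T (ket c))) := by
  have h : (starRingEnd ℂ) ω * ω = 1 := by
    rw [mul_comm, Complex.mul_conj, Complex.normSq_eq_norm_sq, hω]; simp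
  simp only [map_add, map_smul, inner_add_left, inner_add_right, inner_smul_left, inner_smul_right]
  linear_combination inner ℂ (S (ket c')) (T (ket c')) * h

theorem norm_ket_add {c c' : Config n A} (hc : c ≠ c') {ω : ℂ} (hω : ‖ω‖ = 1) :
    ‖(ket c + ω • ket c' : StateSpace n A)‖ ^ 2 = 2 := by
  classical
  have h := inner_map_ket_add (ContinuousLinearMap.id ℂ _) (ContinuousLinearMap.id ℂ _) c c' hω
  simp only [ContinuousLinearMap.id_apply, inner_ket_ket, if_neg hc, if_neg hc.symm,
    mul_zero, add_zero, inner_self_eq_norm_sq_to_K] at h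
  have h' : ((‖(ket c + ω • ket c' : StateSpace n A)‖ ^ 2 : ℝ) : ℂ) = ((2 : ℝ) : ℂ) := by
    push_cast
    simpa [norm_ket, one_add_one_eq_two] using h
  exact_mod_cast h'

/-- The superpositions `|c⟩ + ω|c'⟩` and `|d⟩ + η|d'⟩` have the same reduced state on `S`: their
cross terms either coincide or are both traced out. Causality equates their correlations, and the
diagonal terms cancel, leaving the cross terms. Distinctness of the basis vectors makes the two
norms equal. -/
theorem CausalWith.corr_ket_add {N : Finset (Grid n)} {G : Op n A} (hG : CausalWith N G)
    (x : Grid n) (u v : A) {S : Finset (Grid n)}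
    (hS : N.map (addLeftEmbedding x) = S) {c c' d d' : Config n A} (hc : c ≠ c') (hd : d ≠ d')
    {ω η : ℂ}
    (hω : ‖ω‖ = 1) (hη : ‖η‖ = 1)
    (h1 : ∀ y ∈ S, c y = d y)
    (h2 : ∀ y ∈ S, c' y = d' y)
    (h3 : ((∀ y ∉ S, c y = c' y) ∧
        (∀ y ∉ S, d y = d' y) ∧ ω = η) ∨
      ((¬ ∀ y ∉ S, c y = c' y) ∧
        ¬ ∀ y ∉ S, d y = d' y)) :
    ω * corr G x u v (ket c) (ket c') + (starRingEnd ℂ) ω * corr G x u v (ket c') (ket c) =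
      η * corr G x u v (ket d) (ket d') + (starRingEnd ℂ) η * corr G x u v (ket d') (ket d) := by
  classical
  have r1 : (fun y : S => c y) = fun y : S => d y := funext fun y => h1 y y.2
  have r2 : (fun y : S => c' y) = fun y : S => d' y := funext fun y => h2 y y.2
  have q1 : corr G x u v (ket c) (ket c) = corr G x u v (ket d) (ket d) := by
    refine hG.corr_congr x u v hS (by simp [norm_ket]) fun a b => ?_
    simp only [inner_partialBra_ket, r1, implies_true]
  have q2 : corr G x u v (ket c') (ket c') = corr G x u v (ket d') (ket d') := by
    refine hG.corr_congr x u v hS (by simp [norm_ket]) fun a b => ?_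
    simp only [inner_partialBra_ket, r2, implies_true]
  have q3 := hG.corr_congr x u v hS (ψ := ket c + ω • ket c') (φ := ket d + η • ket d')
    ((pow_left_inj₀ (norm_nonneg _) (norm_nonneg _) two_ne_zero).1
      ((norm_ket_add hc hω).trans (norm_ket_add hd hη).symm)) fun a b => by
    rw [inner_map_ket_add _ _ _ _ hω, inner_map_ket_add _ _ _ _ hη]
    have s1 : (∀ y ∉ S, c' y = c y) ↔ ∀ y ∉ S, c y = c' y := by simp only [eq_comm]
    have s2 : (∀ y ∉ S, d' y = d y) ↔ ∀ y ∉ S, d y = d' y := by simp only [eq_comm]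
    simp only [inner_partialBra_ket, r1, r2, implies_true]
    rcases h3 with ⟨h3, h4, rfl⟩ | ⟨h3, h4⟩
    · simp only [s1, s2, iff_true_intro h3, iff_true_intro h4]
    · simp only [s1, s2, h3, h4, and_false, if_false, mul_zero]
  have q4 := inner_map_ket_add (partialBra {x} (fun _ => u) ∘L G) (partialBra {x} (fun _ => v) ∘L G)
    c c' hω
  have q5 := inner_map_ket_add (partialBra {x} (fun _ => u) ∘L G) (partialBra {x} (fun _ => v) ∘L G)
    d d' hη
  simp only [ContinuousLinearMap.comp_apply] at q4 q5
  simp only [corr] at q1 q2 q3 ⊢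
  rw [q4, q5, q1, q2] at q3
  exact add_left_cancel q3

/-- Observables of a cell are mapped by the evolution to observables of its neighbourhood. -/
theorem CausalWith.isLocalOn {N : Finset (Grid n)} {G : Op n A} (hG : CausalWith N G)
    (x : Grid n) (u v : A) :
    IsLocalOn (N.map (addLeftEmbedding x) : Finset (Grid n))
      fun c c' => corr G x u v (ket c) (ket c') := by
  obtain ⟨S, hS⟩ : ∃ S, N.map (addLeftEmbedding x) = S := ⟨_, rfl⟩
  rw [hS]
  constructor
  · intro c c' y hy hne
    have hcc : c ≠ c' := fun h => hne (by rw [h])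
    have h : ¬ ∀ y ∉ S, c y = c' y := fun h => hne (h y hy)
    -- The cross terms being traced out, the phase has no effect. Comparing 1 with -1, and `I` with
    -- `-I`, kills the sum and the difference of the two conjugate entries.
    have e1 := hG.corr_ket_add x u v hS hcc hcc (ω := 1) (η := -1) (by simp) (by simp)
      (fun _ _ => rfl) (fun _ _ => rfl) (Or.inr ⟨h, h⟩)
    have e2 := hG.corr_ket_add x u v hS hcc hcc (ω := Complex.I) (η := -Complex.I) (by simp) (by simp)
      (fun _ _ => rfl) (fun _ _ => rfl) (Or.inr ⟨h, h⟩)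
    simp only [map_one, map_neg, Complex.conj_I] at e1 e2
    linear_combination (1 / 4 : ℂ) * e1 - (1 / 4 : ℂ) * Complex.I * e2 +
      (1 / 2 : ℂ) * (corr G x u v (ket c) (ket c') - corr G x u v (ket c') (ket c)) *
        Complex.I_mul_I
  · intro c c' d d' h1 h2 h3 h4
    by_cases hcc : c = c'
    · have hdd : d = d' := by
        ext y
        by_cases hy : y ∈ S
        · rw [← h3 y hy, ← h4 y hy, hcc]
        · exact h2 y hy
      subst hcc hdd
      classical
      have r1 : (fun y : S => c y) =
        fun y : S => d y := funext fun y => h3 y y.2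
      refine hG.corr_congr x u v hS (by simp [norm_ket]) fun a b => ?_
      simp only [inner_partialBra_ket, r1, implies_true]
    · have hdd : d ≠ d' := by
        rintro rfl
        refine hcc (Finsupp.ext fun y => ?_)
        by_cases hy : y ∈ S
        · rw [h3 y hy, h4 y hy]
        · exact h1 y hy
      -- Polarization: the phases 1 and `I` identify the sum and the difference of the two conjugate
      -- entries.
      have e1 := hG.corr_ket_add x u v hS hcc hdd (ω := 1) (η := 1) (by simp) (by simp)
        h3 h4 (Or.inl ⟨h1, h2, rfl⟩)
      have e2 := hG.corr_ket_add x u v hS hcc hdd (ω := Complex.I) (η := Complex.I) (by simp) (by simp)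
        h3 h4 (Or.inl ⟨h1, h2, rfl⟩)
      simp only [map_one, Complex.conj_I] at e1 e2
      linear_combination (1 / 2 : ℂ) * e1 - (1 / 2 : ℂ) * Complex.I * e2 +
        (1 / 2 : ℂ) * (corr G x u v (ket c) (ket c') - corr G x u v (ket c') (ket c) -
          (corr G x u v (ket d) (ket d') - corr G x u v (ket d') (ket d))) * Complex.I_mul_I

end Reduced

/-! ### Matrix units of a cell -/

section MatUnit

variable {n : ℕ} {A : Type u} [Zero A]

/-- The matrix unit `|u⟩⟨v|` of the cell `x`. -/
def matUnit (x : Grid n) (u v : A) : Op n A :=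
  embed (glueEmb {x} fun _ => u) ∘L partialBra {x} fun _ => v

theorem inner_matUnit (x : Grid n) (u v : A) (ψ φ : StateSpace n A) :
    inner ℂ ψ (matUnit x u v φ) =
      inner ℂ (partialBra {x} (fun _ => u) ψ) (partialBra {x} (fun _ => v) φ) := by
  rw [matUnit, ContinuousLinearMap.comp_apply, ← ContinuousLinearMap.adjoint_inner_left]
  rfl

theorem corr_eq_inner (G : Op n A) (x : Grid n) (u v : A) (ψ φ : StateSpace n A) :
    corr G x u v ψ φ = inner ℂ (G ψ) (matUnit x u v (G φ)) := (inner_matUnit x u v _ _).symm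

theorem matUnit_apply [DecidableEq A] (x : Grid n) (u v : A) (φ : StateSpace n A)
    (b : Config n A) : matUnit x u v φ b = if b x = u then φ (b.update x v) else 0 := by
  classical
  rw [matUnit, ContinuousLinearMap.comp_apply]
  split_ifs with h
  · obtain ⟨e, he, he'⟩ := exists_glueEmb_eq {x} b
    have hu : (fun y : ({x} : Finset (Grid n)) => b y) = fun _ => u := by
      funext y
      rw [Finset.mem_singleton.1 y.2, h]
    rw [hu] at he
    have h1 := embed_apply (glueEmb {x} fun _ => u) (partialBra {x} (fun _ => v) φ) e
    rw [he] at h1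
    rw [h1, partialBra, restrict_apply]
    refine congrArg (fun c => φ c) (Finsupp.ext fun y => ?_)
    by_cases hy : y = x
    · subst hy
      simp [glueEmb_apply, glue_of_mem]
    · have hy' : y ∉ ({x} : Finset (Grid n)) := by simpa using hy
      rw [glueEmb_apply, glue_of_notMem _ _ hy', he' y hy', Finsupp.update_apply, if_neg hy]
  · refine embed_apply_of_notMem _ _ ?_
    rintro ⟨e, rfl⟩
    exact h (by rw [glueEmb_apply, glue_of_mem _ _ (Finset.mem_singleton_self x)])

/-- This is the relation `(|u⟩⟨v|)† |u'⟩⟨v'| = δ_{uu'} |v⟩⟨v'|`, from which the unitarity of the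
gates follows. -/
theorem inner_matUnit_matUnit [DecidableEq A] (x : Grid n) (u u' v v' : A)
    (ψ φ : StateSpace n A) :
    inner ℂ (matUnit x u v ψ) (matUnit x u' v' φ) =
      if u = u' then inner ℂ ψ (matUnit x v v' φ) else 0 := by
  have h : partialBra {x} (fun _ => u) (matUnit x u' v' φ) =
      if u = u' then partialBra {x} (fun _ => v') φ else 0 := by
    ext e
    have hx : glueEmb {x} (fun _ => u) e x = u := by
      rw [glueEmb_apply, glue_of_mem _ _ (Finset.mem_singleton_self x)]
    rw [partialBra, restrict_apply, matUnit_apply, hx]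
    split_ifs
    · rw [partialBra, restrict_apply]
      refine congrArg (fun c => φ c) (Finsupp.ext fun y => ?_)
      by_cases hy : y = x
      · subst hy
        simp [glueEmb_apply, glue_of_mem]
      · have hy' : y ∉ ({x} : Finset (Grid n)) := by simpa using hy
        rw [Finsupp.update_apply, if_neg hy, glueEmb_apply, glueEmb_apply, glue_of_notMem _ _ hy',
          glue_of_notMem _ _ hy']
    · rfl
  rw [matUnit, ContinuousLinearMap.comp_apply, ← ContinuousLinearMap.adjoint_inner_right]
  change inner ℂ (partialBra {x} (fun _ => v) ψ) (partialBra {x} (fun _ => u) _) = _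
  rw [h]
  split_ifs
  · rw [inner_matUnit]
  · rw [inner_zero_right]

theorem sum_matUnit [Fintype A] [DecidableEq A] (x : Grid n) (φ : StateSpace n A) :
    ∑ u, matUnit x u u φ = φ := by
  ext b
  rw [lp.coeFn_sum, Finset.sum_apply]
  simp [matUnit_apply]

theorem matUnit_ket_zero [DecidableEq A] (x : Grid n) (v : A) :
    matUnit x 0 v (ket 0) = if v = 0 then ket 0 else 0 := by
  classical
  ext b
  rw [matUnit_apply]
  split_ifs with h1 h2 h2
  · subst h2
    rw [show b.update x 0 = b by rw [← h1, Finsupp.update_self]]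
  · rw [ket_apply, if_neg]
    · rfl
    · intro h
      have := DFunLike.congr_fun h x
      simp at this
      exact h2 this
  · rw [ket_apply, if_neg]
    rintro rfl
    exact h1 rfl
  · rfl

theorem translation_apply (v : Grid n) (φ : StateSpace n A) (c : Config n A) :
    translation v φ c = φ ((shift v).symm c) := rfl

theorem translation_ket (v : Grid n) (c : Config n A) :
    translation v (ket c) = ket (shift v c) := relabel_ket _ _

theorem shift_symm_apply (v : Grid n) (c : Config n A) (x : Grid n) :
    (shift v).symm c x = c (x - v) := by
  rw [sub_eq_add_neg]
  rfl

theorem matUnit_translation [DecidableEq A] (x v : Grid n) (u u' : A) (φ : StateSpace n A) :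
    matUnit x u u' (translation v φ) = translation v (matUnit (x + v) u u' φ) := by
  ext b
  rw [translation_apply, matUnit_apply, matUnit_apply, translation_apply, shift_symm_apply,
    add_sub_cancel_right]
  refine if_congr Iff.rfl (congrArg (fun c => φ c) (Finsupp.ext fun y => ?_)) rfl
  classical
  rw [shift_symm_apply, Finsupp.update_apply, Finsupp.update_apply, shift_symm_apply]
  simp [sub_eq_iff_eq_add]

end MatUnit

/-! ### Replacing a supercell of a configuration -/

section UpdateBlock

variable {n : ℕ} {A : Type u} [Zero A] (L : ℕ) [NeZero L]

theorem group_apply (c : Config n A) (x : Grid n) (p : Fin n → Fin L) :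
    group L c x p = c (cellAt L x p) := rfl

/-- The configuration `c` with its supercell `x` replaced by `a`. -/
def updateBlock (c : Config n A) (x : Grid n) (a : Block n L A) : Config n A :=
  (group L).symm ((group L c).update x a)

theorem updateBlock_apply (c : Config n A) (x : Grid n) (a : Block n L A) (y : Grid n) :
    updateBlock L c x a y = if supercellOf L y = x then a (offsetOf L y) else c y := by
  classical
  change (group L c).update x a (supercellOf L y) (offsetOf L y) = _
  rw [Finsupp.update_apply]
  split_ifs
  · rfl
  · rw [group_apply, cellAt_of]

theorem group_updateBlock (c : Config n A) (x : Grid n) (a : Block n L A) :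
    group L (updateBlock L c x a) x = a := by
  classical
  rw [updateBlock, Equiv.apply_symm_apply, Finsupp.update_apply, if_pos rfl]

theorem group_updateBlock_of_ne (c : Config n A) {x y : Grid n} (a : Block n L A) (h : y ≠ x) :
    group L (updateBlock L c x a) y = group L c y := by
  classical
  rw [updateBlock, Equiv.apply_symm_apply, Finsupp.update_apply, if_neg h]

theorem updateBlock_injective (c : Config n A) (x : Grid n) :
    Function.Injective (updateBlock L c x) := fun a b h => by
  rw [← group_updateBlock L c x a, h, group_updateBlock]

theorem updateBlock_group (c : Config n A) (x : Grid n) :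
    updateBlock L c x (group L c x) = c := by
  rw [updateBlock, Finsupp.update_self, Equiv.symm_apply_apply]

theorem eq_updateBlock_iff (c d : Config n A) (x : Grid n) :
    (∃ a, d = updateBlock L c x a) ↔ ∀ y, supercellOf L y ≠ x → d y = c y := by
  constructor
  · rintro ⟨a, rfl⟩ y hy
    rw [updateBlock_apply, if_neg hy]
  · intro h
    refine ⟨group L d x, ?_⟩
    ext y
    rw [updateBlock_apply]
    split_ifs with hy
    · rw [← hy, group_apply, cellAt_of]
    · exact h y hy

end UpdateBlock

/-! ### The local form of the conjugated swap of one cell -/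

/-- A quiescent QCA of radius at most `r`, with causality stated in the Heisenberg picture. -/
structure HasRadius {n : ℕ} {A : Type u} [Zero A] (r : ℕ) (G : Op n A) : Prop where
  unitary : G ∈ unitary (Op n A)
  translation_comm : ∀ (v : Grid n) (ψ : StateSpace n A), G (translation v ψ) = translation v (G ψ)
  quiescent : G (ket 0) = ket 0
  isLocalOn : ∀ (x : Grid n) (u v : A),
    IsLocalOn {y | ∀ i, |y i - x i| ≤ r} fun c c' => corr G x u v (ket c) (ket c')

section Local

variable {n r : ℕ} {A : Type u} [Zero A] {G : Op n A}

variable (n r) in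
/-- The position of the central cell of a supercell of side `2 r + 1`. -/
def center : Fin n → Fin (2 * r + 1) := fun _ => ⟨r, by omega⟩

/-- The central cell of the supercell `x`. -/
def centerOf (r : ℕ) (x : Grid n) : Grid n := cellAt (2 * r + 1) x (center n r)

theorem supercellOf_centerOf (x : Grid n) : supercellOf (2 * r + 1) (centerOf r x) = x :=
  supercellOf_cellAt _ _ _

/-- The side `2r + 1` is chosen for this: the neighbourhood of a central cell stays inside its
supercell. -/
theorem supercellOf_eq_of_near {x y : Grid n} (h : ∀ i, |y i - centerOf r x i| ≤ r) :
    supercellOf (2 * r + 1) y = x := by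
  funext i
  have h1 := abs_le.1 (h i)
  simp only [centerOf, cellAt, center] at h1
  simp only [supercellOf]
  push_cast at h1 ⊢
  rw [Int.ediv_eq_iff_of_pos (by positivity)]
  constructor <;> nlinarith

namespace HasRadius

theorem inner_map (hG : HasRadius r G) (ψ φ : StateSpace n A) :
    inner ℂ (G ψ) (G φ) = inner ℂ ψ φ := by
  rw [← ContinuousLinearMap.adjoint_inner_right]
  have h := DFunLike.congr_fun ((Unitary.mem_iff.1 hG.unitary).1) φ
  rw [← ContinuousLinearMap.star_eq_adjoint]
  exact congrArg (inner ℂ ψ) h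

theorem map_adjoint (hG : HasRadius r G) (ψ : StateSpace n A) : G (G.adjoint ψ) = ψ := by
  have h := DFunLike.congr_fun ((Unitary.mem_iff.1 hG.unitary).2) ψ
  rw [← ContinuousLinearMap.star_eq_adjoint]
  exact h

theorem injective (hG : HasRadius r G) : Function.Injective G := by
  intro ψ φ h
  have h1 : (star G : Op n A) (G ψ) = (star G : Op n A) (G φ) := by rw [h]
  have h2 := fun φ => DFunLike.congr_fun ((Unitary.mem_iff.1 hG.unitary).1) φ
  exact (h2 ψ).symm.trans (h1.trans (h2 φ))

end HasRadius

/-- The matrix, over the supercell of side `2 r + 1` around a cell, of the observable obtained from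
the matrix unit `|u⟩⟨v|` of that cell. -/
def localMat (r : ℕ) (G : Op n A) (u v : A) (a b : Block n (2 * r + 1) A) : ℂ :=
  corr G (centerOf r 0) u v (ket (updateBlock (2 * r + 1) 0 0 a))
    (ket (updateBlock (2 * r + 1) 0 0 b))

namespace HasRadius

theorem corr_eq_zero (hG : HasRadius r G) (x : Grid n) (u v : A) {c d : Config n A} {y : Grid n}
    (hy : supercellOf (2 * r + 1) y ≠ x) (h : d y ≠ c y) :
    corr G (centerOf r x) u v (ket d) (ket c) = 0 :=
  (hG.isLocalOn (centerOf r x) u v).eq_zero d c y (fun h' => hy (supercellOf_eq_of_near h')) h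

theorem corr_translation [DecidableEq A] (hG : HasRadius r G) (x v : Grid n) (u u' : A)
    (c d : Config n A) : corr G x u u' (ket (shift v d)) (ket (shift v c)) =
      corr G (x + v) u u' (ket d) (ket c) := by
  rw [corr_eq_inner, corr_eq_inner, ← translation_ket, ← translation_ket, hG.translation_comm,
    hG.translation_comm, matUnit_translation]
  exact (translation v).inner_map_map _ _

/-- Translation invariance moves the supercell `x` to the origin, and locality then permits emptying
all the other supercells. -/
theorem corr_updateBlock [DecidableEq A] (hG : HasRadius r G) (x : Grid n) (u v : A)
    (c : Config n A) (a : Block n (2 * r + 1) A) :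
    corr G (centerOf r x) u v (ket (updateBlock (2 * r + 1) c x a)) (ket c) =
      localMat r G u v a (group (2 * r + 1) c x) := by
  set w : Grid n := fun i => ((2 * r + 1 : ℕ) : ℤ) * x i with hw
  have hx : centerOf r x = centerOf r 0 + w := by
    funext i
    simp [centerOf, cellAt, hw, add_comm]
  have hc : ∀ p, cellAt (2 * r + 1) 0 p + w = cellAt (2 * r + 1) x p := fun p => by
    funext i
    simp [cellAt, hw, add_comm]
  have hs : ∀ y, supercellOf (2 * r + 1) (y + w) = supercellOf (2 * r + 1) y + x := fun y => by
    funext i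
    simp only [supercellOf, hw, Pi.add_apply]
    rw [Int.add_mul_ediv_left _ _ (by positivity)]
  have ho : ∀ y, offsetOf (2 * r + 1) (y + w) = offsetOf (2 * r + 1) y := fun y => by
    funext i
    simp only [offsetOf, hw, Pi.add_apply, Fin.mk.injEq]
    rw [Int.add_mul_emod_self_left]
  rw [hx, ← hG.corr_translation, localMat]
  have hy0 : ∀ {y}, y ∈ {y | ∀ i, |y i - centerOf r (0 : Grid n) i| ≤ r} →
      supercellOf (2 * r + 1) y = 0 := fun h => supercellOf_eq_of_near h
  have hloc := (hG.isLocalOn (centerOf r 0) u v).mono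
    (T := {y | supercellOf (2 * r + 1) y = 0}) fun y hy => hy0 hy
  refine hloc.congr _ _ _ _ ?_ ?_ ?_ ?_
  · intro y hy
    rw [shift_apply, shift_apply, updateBlock_apply, hs, if_neg]
    intro h
    exact hy (by simpa using h)
  · intro y hy
    have hy' : supercellOf (2 * r + 1) y ≠ 0 := hy
    rw [updateBlock_apply, updateBlock_apply, if_neg hy', if_neg hy']
  · intro y hy
    have hy' : supercellOf (2 * r + 1) y = 0 := hy
    rw [shift_apply, updateBlock_apply, updateBlock_apply, hs, ho, hy', zero_add, if_pos rfl,
      if_pos rfl]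
  · intro y hy
    have hy' : supercellOf (2 * r + 1) y = 0 := hy
    rw [shift_apply, updateBlock_apply, if_pos hy', group_apply, ← hc, ← hy', cellAt_of]

/-- Since `G` fixes `|0⟩`, so does `G† |0⟩⟨0|_x G`, while `G† |0⟩⟨v|_x G` kills it for `v ≠ 0`. This
gives the quiescence of the gate. -/
theorem localMat_zero [DecidableEq A] (hG : HasRadius r G) (v : A) (a : Block n (2 * r + 1) A) :
    localMat r G 0 v a 0 = if v = 0 ∧ a = 0 then 1 else 0 := by
  classical
  have h0 : updateBlock (2 * r + 1) (0 : Config n A) 0 0 = 0 :=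
    updateBlock_group (2 * r + 1) (0 : Config n A) 0
  rw [localMat, corr_eq_inner, h0, hG.quiescent, matUnit_ket_zero]
  by_cases hv : v = 0
  · rw [if_pos hv]
    conv_lhs => rw [← hG.quiescent]
    rw [hG.inner_map, inner_ket_ket]
    simp only [hv, true_and]
    refine if_congr ?_ rfl rfl
    constructor
    · intro h
      exact updateBlock_injective (2 * r + 1) 0 0 (h.trans h0.symm)
    · rintro rfl
      exact h0
  · simp [hv]

variable [Fintype A] [DecidableEq A]

/-- By locality, `G† |u⟩⟨v| G |c⟩` involves only configurations that differ from `c` inside the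
supercell `x`, which makes the expansion a finite sum. Applying `G` removes the adjoint. -/
theorem matUnit_map_ket (hG : HasRadius r G) (x : Grid n) (u v : A) (c : Config n A) :
    matUnit (centerOf r x) u v (G (ket c)) =
      ∑ a, localMat r G u v a (group (2 * r + 1) c x) •
        G (ket (updateBlock (2 * r + 1) c x a)) := by
  classical
  have h : G.adjoint (matUnit (centerOf r x) u v (G (ket c))) =
      ∑ a, localMat r G u v a (group (2 * r + 1) c x) •
        (ket (updateBlock (2 * r + 1) c x a) : StateSpace n A) := by
    ext d
    rw [← inner_ket_left, ContinuousLinearMap.adjoint_inner_right, ← corr_eq_inner,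
      lp.coeFn_sum, Finset.sum_apply]
    simp only [lp.coeFn_smul, Pi.smul_apply, ket_apply, smul_eq_mul, mul_ite, mul_one, mul_zero]
    by_cases hd : ∃ a, d = updateBlock (2 * r + 1) c x a
    · obtain ⟨a, rfl⟩ := hd
      simp only [(updateBlock_injective _ c x).eq_iff, hG.corr_updateBlock]
      simp
    · rw [Finset.sum_eq_zero]
      · rw [eq_updateBlock_iff] at hd
        push Not at hd
        obtain ⟨y, hy, hne⟩ := hd
        exact hG.corr_eq_zero x u v hy hne
      · intro a _
        exact if_neg fun h => hd ⟨a, h⟩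
  have h' := congrArg G h
  rw [hG.map_adjoint, map_sum] at h'
  simpa only [map_smul] using h'

theorem sum_localMat_mul (hG : HasRadius r G) (x : Grid n) (u v : A) (c b : Config n A) :
    ∑ a, localMat r G u v a (group (2 * r + 1) c x) *
        G (ket (updateBlock (2 * r + 1) c x a)) b =
      if b (centerOf r x) = u then G (ket c) (b.update (centerOf r x) v) else 0 := by
  rw [← matUnit_apply, hG.matUnit_map_ket, lp.coeFn_sum, Finset.sum_apply]
  rfl

/-- For fixed `v` the inner sum is `δ_{uu'} ⟨G b| (|v⟩⟨v|) |G b'⟩`. Summing over `v` removes the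
projectors, and `G` preserves inner products. -/
theorem sum_localMat_conj (hG : HasRadius r G) (u u' : A) (b b' : Block n (2 * r + 1) A) :
    ∑ v, ∑ a, star (localMat r G u v a b) * localMat r G u' v a b' =
      if u = u' ∧ b = b' then 1 else 0 := by
  classical
  set f : Block n (2 * r + 1) A → Config n A := updateBlock (2 * r + 1) 0 0 with hf
  have key : ∀ v, ∑ a, star (localMat r G u v a b) * localMat r G u' v a b' =
      inner ℂ (matUnit (centerOf r 0) u v (G (ket (f b))))
        (matUnit (centerOf r 0) u' v (G (ket (f b')))) := by
    intro v
    have hupd : ∀ a b : Block n (2 * r + 1) A, updateBlock (2 * r + 1) (f b) 0 a = f a := by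
      intro a b
      ext y
      simp only [hf, updateBlock_apply]
      split_ifs <;> rfl
    rw [hG.matUnit_map_ket, hG.matUnit_map_ket]
    simp only [hf, group_updateBlock]
    simp only [← hf, hupd, sum_inner, inner_sum, inner_smul_left, inner_smul_right, hG.inner_map,
      inner_ket_ket]
    simp [hf, (updateBlock_injective _ _ _).eq_iff, mul_comm]
  simp only [key, inner_matUnit_matUnit]
  by_cases hu : u = u'
  · simp only [hu, if_true, true_and]
    rw [← inner_sum, sum_matUnit, hG.inner_map, inner_ket_ket]
    simp [hf, (updateBlock_injective _ _ _).eq_iff]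
  · simp [hu]

/-- The gate that exchanges the two layers of the central cell, conjugated by the evolution of the
first layer. -/
def gate (hG : HasRadius r G) :
    LocalIsometry (Block n (2 * r + 1) (A × A)) (Block n (2 * r + 1) (A × A)) where
  mat := Matrix.of fun w' w =>
    if ∀ p, p ≠ center n r → (w' p).2 = (w p).2 then
      localMat r G (w (center n r)).2 (w' (center n r)).2 (fun p => (w' p).1) (fun p => (w p).1)
    else 0
  isometry := by
    ext w w'
    simp only [Matrix.mul_apply, Matrix.conjTranspose_apply, Matrix.of_apply, Matrix.one_apply]
    refine (Fintype.sum_equiv (Equiv.arrowProdEquivProdArrow _ _ _) _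
      (fun q : (Block n (2 * r + 1) A) × (Block n (2 * r + 1) A) =>
        star (if ∀ p, p ≠ center n r → q.2 p = (w p).2 then
          localMat r G (w (center n r)).2 (q.2 (center n r)) q.1 (fun p => (w p).1) else 0) *
        (if ∀ p, p ≠ center n r → q.2 p = (w' p).2 then
          localMat r G (w' (center n r)).2 (q.2 (center n r)) q.1 (fun p => (w' p).1) else 0))
      fun q => rfl).trans ?_
    rw [Fintype.sum_prod_type_right]
    by_cases hw : ∀ p, p ≠ center n r → (w p).2 = (w' p).2
    · have hsum := hG.sum_localMat_conj (w (center n r)).2 (w' (center n r)).2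
        (fun p => (w p).1) (fun p => (w' p).1)
      have hiff : ((w (center n r)).2 = (w' (center n r)).2 ∧
          (fun p => (w p).1) = fun p => (w' p).1) ↔ w = w' := by
        constructor
        · rintro ⟨h1, h2⟩
          funext p
          refine Prod.ext (congrFun h2 p) ?_
          by_cases hp : p = center n r
          · rw [hp, h1]
          · exact hw p hp
        · rintro rfl
          exact ⟨rfl, rfl⟩
      rw [if_congr hiff rfl rfl] at hsum
      rw [← hsum]
      symm
      -- A second layer contributes only if it agrees with that of `w` off the centre, so it is
      -- determined by its central letter `v`.
      refine Fintype.sum_of_injective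
        (fun v : A => Function.update (fun p => (w p).2) (center n r) v) ?_ _ _ ?_ ?_
      · intro v v' h
        simpa using congrFun h (center n r)
      · intro ν hν
        refine Finset.sum_eq_zero fun a _ => ?_
        rw [if_neg, star_zero, zero_mul]
        intro h
        refine hν ⟨ν (center n r), ?_⟩
        funext p
        by_cases hp : p = center n r
        · subst hp; simp
        · simpa [hp] using (h p hp).symm
      · intro v
        refine Finset.sum_congr rfl fun a _ => ?_
        rw [if_pos, if_pos]
        · simp
        · intro p hp
          simp [hp, hw p hp]
        · intro p hp
          simp [hp]
    · rw [if_neg (by rintro rfl; exact hw fun _ _ => rfl)]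
      refine Finset.sum_eq_zero fun ν _ => Finset.sum_eq_zero fun a _ => ?_
      by_cases h1 : ∀ p, p ≠ center n r → ν p = (w p).2
      · rw [if_neg (c := ∀ p, p ≠ center n r → ν p = (w' p).2), mul_zero]
        exact fun h2 => hw fun p hp => (h1 p hp).symm.trans (h2 p hp)
      · rw [if_neg h1, star_zero, zero_mul]
  quiescent := by
    ext w
    simp only [Matrix.mulVec_single_one, Matrix.col_apply, Matrix.of_apply, Pi.single_apply]
    have h := hG.localMat_zero (w (center n r)).2 fun p => (w p).1
    simp only [Pi.zero_apply, Prod.snd_zero, Prod.fst_zero]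
    change (if _ then localMat r G 0 _ _ 0 else 0) = _
    rw [h, ← ite_and]
    refine if_congr ?_ rfl rfl
    constructor
    · rintro ⟨h1, h2, h3⟩
      funext p
      refine Prod.ext (congrFun h3 p) ?_
      by_cases hp : p = center n r
      · rw [hp, h2]; rfl
      · exact h1 p hp
    · rintro rfl
      exact ⟨fun _ _ => rfl, rfl, rfl⟩

theorem gate_mat (hG : HasRadius r G) (w' w : Block n (2 * r + 1) (A × A)) :
    hG.gate.mat w' w = if ∀ p, p ≠ center n r → (w' p).2 = (w p).2 then
      localMat r G (w (center n r)).2 (w' (center n r)).2 (fun p => (w' p).1) (fun p => (w p).1)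
    else 0 := rfl

end HasRadius

end Local

/-! ### Two-layered configurations -/

section Layers

variable {n : ℕ} {A : Type u} [Zero A]

/-- The two-layered configuration with layers `b` and `β`. -/
def layers (b β : Config n A) : Config n (A × A) := Finsupp.zipWith Prod.mk rfl b β

theorem layers_apply (b β : Config n A) (x : Grid n) : layers b β x = (b x, β x) := rfl

theorem exists_layers_eq (q : Config n (A × A)) : ∃ b β, layers b β = q :=
  ⟨q.mapRange Prod.fst rfl, q.mapRange Prod.snd rfl, by ext x <;> rfl⟩

theorem layers_inj {b β b' β' : Config n A} : layers b β = layers b' β' ↔ b = b' ∧ β = β' := by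
  constructor
  · intro h
    exact ⟨Finsupp.ext fun x => congrArg Prod.fst (DFunLike.congr_fun h x),
      Finsupp.ext fun x => congrArg Prod.snd (DFunLike.congr_fun h x)⟩
  · rintro ⟨rfl, rfl⟩
    rfl

/-- Two-layered configurations with second layer `β`. -/
def withSecond (β : Config n A) : Config n A ↪ Config n (A × A) :=
  ⟨fun b => layers b β, fun _ _ h => (layers_inj.1 h).1⟩

/-- Two-layered configurations with first layer `b`. -/
def withFirst (b : Config n A) : Config n A ↪ Config n (A × A) :=
  ⟨fun β => layers b β, fun _ _ h => (layers_inj.1 h).2⟩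

theorem restrict_withSecond_ket [DecidableEq A] (β b β' : Config n A) :
    restrict (withSecond β) (ket (layers b β')) = if β = β' then ket b else 0 := by
  classical
  split_ifs with h
  · subst h
    exact restrict_ket (withSecond β) b
  · refine restrict_ket_of_notMem _ ?_
    rintro ⟨b', hb'⟩
    exact h (layers_inj.1 hb').2

open Classical in
/-- The configuration that coincides with `β` on `S` and with `b` elsewhere. -/
def mix (S : Set (Grid n)) (b β : Config n A) : Config n A :=
  Finsupp.onFinset (b.support ∪ β.support) (fun x => if x ∈ S then β x else b x) fun x hx => by
    by_cases h : x ∈ S <;> simp_all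

theorem mix_of_mem {S : Set (Grid n)} (b β : Config n A) {x : Grid n} (h : x ∈ S) :
    mix S b β x = β x := by
  simp [mix, h]

theorem mix_of_notMem {S : Set (Grid n)} (b β : Config n A) {x : Grid n} (h : x ∉ S) :
    mix S b β x = b x := by
  simp [mix, h]

theorem mix_empty (b β : Config n A) : mix ∅ b β = b :=
  Finsupp.ext fun x => mix_of_notMem b β (Set.notMem_empty x)

theorem mix_univ (b β : Config n A) : mix Set.univ b β = β :=
  Finsupp.ext fun x => mix_of_mem b β (Set.mem_univ x)

theorem mix_mix {S T : Set (Grid n)} (h : Disjoint S T) (b β : Config n A) :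
    mix S (mix T b β) (mix T β b) = mix (S ∪ T) b β := by
  ext x
  by_cases hS : x ∈ S
  · have hT : x ∉ T := Set.disjoint_left.1 h hS
    rw [mix_of_mem _ _ hS, mix_of_notMem _ _ hT, mix_of_mem _ _ (Or.inl hS)]
  · rw [mix_of_notMem _ _ hS]
    by_cases hT : x ∈ T
    · rw [mix_of_mem _ _ hT, mix_of_mem _ _ (Or.inr hT)]
    · rw [mix_of_notMem _ _ hT, mix_of_notMem]
      rintro (h | h)
      exacts [hS h, hT h]

theorem shift_layers (v : Grid n) (b β : Config n A) :
    shift v (layers b β) = layers (shift v b) (shift v β) :=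
  Finsupp.ext fun _ => rfl

theorem shift_mix (v : Grid n) (S : Set (Grid n)) (b β : Config n A) :
    shift v (mix S b β) = mix ((· + v) ⁻¹' S) (shift v b) (shift v β) := by
  ext x
  rw [shift_apply]
  by_cases h : x + v ∈ S
  · rw [mix_of_mem _ _ h, mix_of_mem _ _ (show x ∈ (· + v) ⁻¹' S from h), shift_apply]
  · rw [mix_of_notMem _ _ h, mix_of_notMem _ _ (show x ∉ (· + v) ⁻¹' S from h), shift_apply]

end Layers

/-! ### Exchanging the layers of all central cells -/

section Exchange

variable {n r : ℕ} {A : Type u} [Zero A] [Fintype A] [DecidableEq A] {G : Op n A}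

/-- The central cells of the supercells that belong to `F`. -/
def centersIn (r : ℕ) (F : Set (Grid n)) : Set (Grid n) :=
  {y | offsetOf (2 * r + 1) y = center n r ∧ supercellOf (2 * r + 1) y ∈ F}

theorem mem_centersIn_iff {F : Set (Grid n)} {y : Grid n} :
    y ∈ centersIn r F ↔ ∃ x ∈ F, y = centerOf r x := by
  constructor
  · rintro ⟨h1, h2⟩
    refine ⟨_, h2, ?_⟩
    rw [centerOf, ← h1, cellAt_of]
  · rintro ⟨x, hx, rfl⟩
    refine ⟨offsetOf_cellAt _ _ _, ?_⟩
    rwa [supercellOf_centerOf]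

theorem centerOf_injective : Function.Injective (centerOf r : Grid n → Grid n) := fun x y h => by
  rw [← supercellOf_centerOf (r := r) x, h, supercellOf_centerOf]

theorem centerOf_mem_centersIn {F : Set (Grid n)} {x : Grid n} :
    centerOf r x ∈ centersIn r F ↔ x ∈ F := by
  rw [mem_centersIn_iff]
  constructor
  · rintro ⟨y, hy, h⟩
    rwa [centerOf_injective h]
  · exact fun h => ⟨x, h, rfl⟩

namespace HasRadius

open Classical in
-- `Ψ` is the component of the gates of `F` applied to `|c⟩` in which the central letters of the
-- second layer pass from `β₀` to `β`. It has two descriptions: a product of local entries, because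
-- the supercells are disjoint, and, after applying `G`, an exchange of letters at the centres.
theorem exists_finite_product (hG : HasRadius r G) (β₀ β : Config n A) (F : Finset (Grid n))
    (c : Config n A) :
    ∃ Ψ : StateSpace n A,
      (∀ d, Ψ d = if ∀ y, supercellOf (2 * r + 1) y ∉ F → d y = c y then
        ∏ x ∈ F, localMat r G (β₀ (centerOf r x)) (β (centerOf r x)) (group (2 * r + 1) d x)
          (group (2 * r + 1) c x) else 0) ∧
      ∀ b, G Ψ b = if ∀ x ∈ F, b (centerOf r x) = β₀ (centerOf r x) then
        G (ket c) (mix (centersIn r F) b β) else 0 := by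
  classical
  induction F using Finset.induction_on generalizing c with
  | empty =>
    refine ⟨ket c, fun d => ?_, fun b => ?_⟩
    · rw [ket_apply, Finset.prod_empty]
      refine if_congr ?_ rfl rfl
      simp [Finsupp.ext_iff]
    · rw [if_pos (by simp)]
      have : centersIn r ((∅ : Finset (Grid n)) : Set (Grid n)) = ∅ := by
        ext y
        simp [centersIn]
      rw [this, mix_empty]
  | insert x F hx ih =>
    -- The gate of `x` acts first, turning `c` into a combination of its updates at `x`, each of
    -- which is then handled by the gates of `F`.
    choose Ψ hΨ hGΨ using fun a => ih (updateBlock (2 * r + 1) c x a)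
    refine ⟨∑ a, localMat r G (β₀ (centerOf r x)) (β (centerOf r x)) a
      (group (2 * r + 1) c x) • Ψ a, fun d => ?_, fun b => ?_⟩
    · rw [lp.coeFn_sum, Finset.sum_apply]
      simp only [lp.coeFn_smul, Pi.smul_apply, smul_eq_mul, hΨ]
      rw [Finset.sum_eq_single (group (2 * r + 1) d x)]
      · rw [Finset.prod_insert hx, mul_ite, mul_zero]
        refine if_congr ?_ ?_ rfl
        · constructor
          · intro h y hy
            rw [Finset.mem_insert, not_or] at hy
            rw [h y hy.2, updateBlock_apply, if_neg hy.1]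
          · intro h y hy
            rw [updateBlock_apply]
            split_ifs with hyx
            · rw [← hyx, group_apply, cellAt_of]
            · exact h y (by simp [hyx, hy])
        · congr 1
          refine Finset.prod_congr rfl fun y hy => ?_
          rw [group_updateBlock_of_ne]
          rintro rfl
          exact hx hy
      · intro a _ ha
        rw [if_neg, mul_zero]
        intro h
        refine ha ?_
        funext p
        rw [group_apply, h _ (by rwa [supercellOf_cellAt]), updateBlock_apply,
          supercellOf_cellAt, if_pos rfl, offsetOf_cellAt]
      · simp
    · rw [map_sum, lp.coeFn_sum, Finset.sum_apply]
      simp only [map_smul, lp.coeFn_smul, Pi.smul_apply, smul_eq_mul, hGΨ]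
      simp only [Finset.forall_mem_insert]
      by_cases hF : ∀ y ∈ F, b (centerOf r y) = β₀ (centerOf r y)
      · simp only [iff_true_intro hF, if_true, and_true]
        rw [hG.sum_localMat_mul, mix_of_notMem _ _ (by simpa [centerOf_mem_centersIn] using hx)]
        refine if_congr Iff.rfl (congrArg (fun c' => G (ket c) c') (Finsupp.ext fun y => ?_)) rfl
        rw [Finsupp.update_apply]
        by_cases hy : y = centerOf r x
        · rw [if_pos hy, hy, mix_of_mem _ _ (by simp [centerOf_mem_centersIn])]
        · rw [if_neg hy]
          have hiff : y ∈ centersIn r ((insert x F : Finset (Grid n)) : Set (Grid n)) ↔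
              y ∈ centersIn r (F : Set (Grid n)) := by
            rw [mem_centersIn_iff, mem_centersIn_iff]
            simp [hy]
          by_cases hyF : y ∈ centersIn r (F : Set (Grid n))
          · rw [mix_of_mem _ _ hyF, mix_of_mem _ _ (hiff.2 hyF)]
          · rw [mix_of_notMem _ _ hyF, mix_of_notMem _ _ (fun h => hyF (hiff.1 h))]
      · simp [hF]

/-- This is `(G ⊗ 1) (⨂ gate) = S (G ⊗ 1)` on a basis vector, `S` exchanging the layers at all
central cells; the entry at `(b, β)` is written without forming `G ⊗ 1`. -/
theorem map_restrict_tensor_gate_ket (hG : HasRadius r G) (b β b₀ β₀ : Config n A) :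
    G (restrict (withSecond β) (conjRelabel (group (2 * r + 1)).symm (hG.gate.tensor n)
        (ket (layers b₀ β₀)))) b =
      G (restrict (withSecond (mix (centersIn r Set.univ) β b)) (ket (layers b₀ β₀)))
        (mix (centersIn r Set.univ) b β) := by
  classical
  rw [restrict_withSecond_ket]
  have hcoord : ∀ d, restrict (withSecond β) (conjRelabel (group (2 * r + 1)).symm
      (hG.gate.tensor n) (ket (layers b₀ β₀))) d =
        ∏ᶠ x, hG.gate.mat (group (2 * r + 1) (layers d β) x)
          (group (2 * r + 1) (layers b₀ β₀) x) := by
    intro d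
    rw [restrict_apply, conjRelabel_apply, relabel_ket, LocalIsometry.tensor_ket]
    rfl
  -- Gates leave the second layer unchanged off the centres, so both sides vanish if `β` and `β₀`
  -- differ there.
  by_cases hoff : ∀ y ∉ centersIn r Set.univ, β y = β₀ y
  swap
  · rw [if_neg, map_zero]
    swap
    · intro h
      refine hoff fun y hy => ?_
      rw [← h, mix_of_notMem _ _ hy]
    push Not at hoff
    obtain ⟨y, hy, hne⟩ := hoff
    have hz : restrict (withSecond β) (conjRelabel (group (2 * r + 1)).symm
        (hG.gate.tensor n) (ket (layers b₀ β₀))) = 0 := by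
      ext d
      rw [hcoord]
      refine finprod_eq_zero _ (supercellOf (2 * r + 1) y) ?_
        (LocalIsometry.finite_mulSupport _ _ _)
      rw [gate_mat, if_neg]
      intro h
      have := h (offsetOf (2 * r + 1) y) fun h' => hy ⟨h', Set.mem_univ _⟩
      simp only [group_apply, cellAt_of, layers_apply] at this
      exact hne this
    rw [hz, map_zero]
    rfl
  -- Outside these supercells the input is empty, so by quiescence the gates leave it empty, and the
  -- infinite product reduces to the finite one.
  set F : Finset (Grid n) := (b.support ∪ β.support ∪ (b₀.support ∪ β₀.support)).image
    (supercellOf (2 * r + 1)) with hF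
  have hF0 : ∀ y, supercellOf (2 * r + 1) y ∉ F → b y = 0 ∧ β y = 0 ∧ b₀ y = 0 ∧ β₀ y = 0 := by
    intro y hy
    have : y ∉ b.support ∪ β.support ∪ (b₀.support ∪ β₀.support) := fun h =>
      hy (Finset.mem_image_of_mem _ h)
    simpa [not_or, and_assoc] using this
  obtain ⟨Ψ, hΨ, hGΨ⟩ := hG.exists_finite_product β₀ β F b₀
  have hΨeq : restrict (withSecond β) (conjRelabel (group (2 * r + 1)).symm
      (hG.gate.tensor n) (ket (layers b₀ β₀))) = Ψ := by
    ext d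
    rw [hcoord, hΨ]
    have hfac : ∀ x, hG.gate.mat (group (2 * r + 1) (layers d β) x)
        (group (2 * r + 1) (layers b₀ β₀) x) = localMat r G (β₀ (centerOf r x))
          (β (centerOf r x)) (group (2 * r + 1) d x) (group (2 * r + 1) b₀ x) := by
      intro x
      rw [gate_mat, if_pos]
      · rfl
      · intro p hp
        refine hoff _ fun h => hp ?_
        rw [← h.1, offsetOf_cellAt]
    have hout : ∀ x ∉ F, hG.gate.mat (group (2 * r + 1) (layers d β) x)
        (group (2 * r + 1) (layers b₀ β₀) x) =
          if group (2 * r + 1) (layers d β) x = 0 then 1 else 0 := by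
      intro x hx
      have : group (2 * r + 1) (layers b₀ β₀) x = 0 := by
        funext p
        have := hF0 (cellAt (2 * r + 1) x p) (by rwa [supercellOf_cellAt])
        rw [group_apply, layers_apply, this.2.2.1, this.2.2.2]
        rfl
      rw [this, LocalIsometry.mat_zero]
    split_ifs with hd
    · rw [finprod_eq_prod_of_mulSupport_subset (s := F)]
      · exact Finset.prod_congr rfl fun x _ => hfac x
      · intro x hx
        by_contra hxF
        refine hx ?_
        dsimp only
        rw [hout x hxF, if_pos]
        funext p
        have hp : supercellOf (2 * r + 1) (cellAt (2 * r + 1) x p) ∉ F := by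
          rwa [supercellOf_cellAt]
        rw [group_apply, layers_apply, hd _ hp, (hF0 _ hp).2.1, (hF0 _ hp).2.2.1]
        rfl
    · push Not at hd
      obtain ⟨y, hy, hne⟩ := hd
      refine finprod_eq_zero _ (supercellOf (2 * r + 1) y) ?_
        (LocalIsometry.finite_mulSupport _ _ _)
      rw [hout _ hy, if_neg]
      intro h
      have := congrArg Prod.fst (congrFun h (offsetOf (2 * r + 1) y))
      rw [group_apply, cellAt_of, layers_apply] at this
      exact hne (this.trans (hF0 y hy).2.2.1.symm)
  rw [hΨeq, hGΨ]
  have hiff : (∀ x ∈ F, b (centerOf r x) = β₀ (centerOf r x)) ↔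
      mix (centersIn r Set.univ) β b = β₀ := by
    constructor
    · intro h
      ext y
      by_cases hy : y ∈ centersIn r Set.univ
      · rw [mix_of_mem _ _ hy]
        obtain ⟨x, -, rfl⟩ := mem_centersIn_iff.1 hy
        by_cases hx : x ∈ F
        · exact h x hx
        · have := hF0 (centerOf r x) (by rwa [supercellOf_centerOf])
          rw [this.1, this.2.2.2]
      · rw [mix_of_notMem _ _ hy, hoff y hy]
    · rintro h x -
      rw [← h, mix_of_mem]
      exact centerOf_mem_centersIn.2 (Set.mem_univ _)
  have hmix : mix (centersIn r F) b β = mix (centersIn r Set.univ) b β := by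
    ext y
    by_cases hy : y ∈ centersIn r Set.univ
    · rw [mix_of_mem _ _ hy]
      by_cases hyF : supercellOf (2 * r + 1) y ∈ F
      · rw [mix_of_mem _ _ (show y ∈ centersIn r (F : Set (Grid n)) from ⟨hy.1, hyF⟩)]
      · rw [mix_of_notMem _ _ fun h => hyF h.2, (hF0 y hyF).1, (hF0 y hyF).2.1]
    · rw [mix_of_notMem _ _ hy, mix_of_notMem _ _ fun h => hy ⟨h.1, Set.mem_univ _⟩]
  rw [if_congr hiff rfl rfl, hmix]
  split_ifs
  · rfl
  · rw [map_zero]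
    rfl

theorem map_restrict_tensor_gate (hG : HasRadius r G) (b β : Config n A)
    (Ψ : StateSpace n (A × A)) :
    G (restrict (withSecond β) (conjRelabel (group (2 * r + 1)).symm (hG.gate.tensor n) Ψ)) b =
      G (restrict (withSecond (mix (centersIn r Set.univ) β b)) Ψ)
        (mix (centersIn r Set.univ) b β) := by
  have h : (innerSL ℂ (ket b : StateSpace n A)) ∘L G ∘L restrict (withSecond β) ∘L
        conjRelabel (group (2 * r + 1)).symm (hG.gate.tensor n) =
      (innerSL ℂ (ket (mix (centersIn r Set.univ) b β) : StateSpace n A)) ∘L G ∘L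
        restrict (withSecond (mix (centersIn r Set.univ) β b)) := by
    refine clm_ext_ket fun q => ?_
    obtain ⟨b₀, β₀, rfl⟩ := exists_layers_eq q
    simp only [ContinuousLinearMap.comp_apply, innerSL_apply_apply, inner_ket_left]
    exact hG.map_restrict_tensor_gate_ket b β b₀ β₀
  have h' := DFunLike.congr_fun h Ψ
  simpa only [ContinuousLinearMap.comp_apply, innerSL_apply_apply, inner_ket_left] using h'

end HasRadius

end Exchange

/-! ### The circuit of a quiescent QCA -/

section CircuitOfQCA

variable {n r : ℕ} {A : Type u} [Zero A] {G : Op n A}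

theorem restrict_translation_symm (v : Grid n) (β : Config n A) (Φ : StateSpace n (A × A)) :
    restrict (withSecond β) ((translation v).symm Φ) =
      (translation v).symm (restrict (withSecond (shift v β)) Φ) := by
  ext d
  rw [restrict_apply]
  change Φ (shift v (layers d β)) = restrict (withSecond (shift v β)) Φ (shift v d)
  rw [restrict_apply, shift_layers]
  rfl

/-- The cells on which the gates of offset `c` exchange the layers. -/
def exchanged (r : ℕ) (c : Fin n → Fin (2 * r + 1)) : Set (Grid n) :=
  {y | y - toGrid c ∈ centersIn r Set.univ}

theorem emod_sub_eq {y c M ρ : ℤ} (hc : 0 ≤ c) (hcM : c < M) (h : (y - c) % M = ρ) :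
    (y - ρ) % M = c := by
  rw [← h, Int.sub_emod_emod, sub_sub_cancel, Int.emod_eq_of_lt hc hcM]

/-- The offset is read off the cell modulo `2r + 1`, hence each cell is exchanged by the gates of
exactly one offset. -/
theorem mem_exchanged_iff (c : Fin n → Fin (2 * r + 1)) (y : Grid n) :
    y ∈ exchanged r c ↔ offsetOf (2 * r + 1) (y - fun _ => (r : ℤ)) = c := by
  have h : y ∈ exchanged r c ↔ offsetOf (2 * r + 1) (y - toGrid c) = center n r :=
    ⟨fun h => h.1, fun h => ⟨h, Set.mem_univ _⟩⟩
  rw [h, funext_iff, funext_iff]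
  refine forall_congr' fun i => ?_
  have hc := (c i).2
  simp only [offsetOf, toGrid, center, Fin.ext_iff, Pi.sub_apply]
  push_cast
  have hL : (0 : ℤ) < 2 * r + 1 := by positivity
  have a1 := Int.emod_nonneg (y i - (c i : ℕ)) hL.ne'
  have a2 := Int.emod_nonneg (y i - r) hL.ne'
  have a3 := Int.emod_lt_of_pos (y i - (c i : ℕ)) hL
  have a4 := Int.emod_lt_of_pos (y i - r) hL
  constructor
  · intro h
    have h' : (y i - (c i : ℕ)) % (2 * r + 1) = r := by omega
    have h2 := emod_sub_eq (by omega) (by omega) h'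
    omega
  · intro h
    have h' : (y i - r) % (2 * r + 1) = (c i : ℕ) := by omega
    have h2 := emod_sub_eq (by omega) (by omega) h'
    omega

namespace HasRadius

theorem translation_symm_comm (hG : HasRadius r G) (v : Grid n) (ψ : StateSpace n A) :
    G ((translation v).symm ψ) = (translation v).symm (G ψ) := by
  apply (translation v).injective
  rw [← hG.translation_comm, LinearIsometryEquiv.apply_symm_apply,
    LinearIsometryEquiv.apply_symm_apply]

theorem map_restrict_translation_symm (hG : HasRadius r G) (v : Grid n) (b β : Config n A)
    (Φ : StateSpace n (A × A)) :
    G (restrict (withSecond β) ((translation v).symm Φ)) b =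
      G (restrict (withSecond (shift v β)) Φ) (shift v b) := by
  rw [restrict_translation_symm, hG.translation_symm_comm]
  rfl

/-- Injectivity of `G ⊗ 1`, in terms of amplitudes. -/
theorem ext_map_restrict (hG : HasRadius r G) {Φ Φ' : StateSpace n (A × A)}
    (h : ∀ b β, G (restrict (withSecond β) Φ) b = G (restrict (withSecond β) Φ') b) : Φ = Φ' := by
  ext q
  obtain ⟨b, β, rfl⟩ := exists_layers_eq q
  have h1 : restrict (withSecond β) Φ = restrict (withSecond β) Φ' := by
    apply hG.injective
    ext b
    exact h b β
  have h2 := congrArg (fun φ : StateSpace n A => φ b) h1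
  simp only [restrict_apply] at h2
  exact h2

variable [Fintype A] [DecidableEq A]

theorem map_restrict_gateAt (hG : HasRadius r G) (c : Fin n → Fin (2 * r + 1))
    (b β : Config n A) (Ψ : StateSpace n (A × A)) :
    G (restrict (withSecond β) (gateAt c hG.gate Ψ)) b =
      G (restrict (withSecond (mix (exchanged r c) β b)) Ψ) (mix (exchanged r c) b β) := by
  have h1 : gateAt c hG.gate Ψ = (translation (toGrid c)).symm
      (conjRelabel (group (2 * r + 1)).symm (hG.gate.tensor n) (translation (toGrid c) Ψ)) := rfl
  have h2 : ∀ b β : Config n A, mix (centersIn r Set.univ) (shift (toGrid c) b)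
      (shift (toGrid c) β) = shift (toGrid c) (mix (exchanged r c) b β) := by
    intro b β
    rw [shift_mix]
    congr 1
    ext y
    simp [exchanged]
  rw [h1, hG.map_restrict_translation_symm, hG.map_restrict_tensor_gate, h2, h2,
    ← hG.map_restrict_translation_symm, LinearIsometryEquiv.symm_apply_apply]

end HasRadius

variable [Fintype A] [DecidableEq A]

theorem swap_block_injective (n L : ℕ) (A : Type u) :
    Function.Injective fun (w : Block n L (A × A)) p => (w p).swap :=
  fun _ _ h => funext fun p => Prod.swap_injective (congrFun h p)

/-- The gate that exchanges the two layers of all the cells of a supercell. -/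
def swapGate (n L : ℕ) (A : Type u) [Zero A] [Fintype A] [DecidableEq A] :
    LocalIsometry (Block n L (A × A)) (Block n L (A × A)) :=
  LocalIsometry.ofInjective (fun w p => (w p).swap) (swap_block_injective n L A) rfl

theorem gateAt_swapGate {L : ℕ} [NeZero L] (c : Fin n → Fin L) (χ : StateSpace n A) :
    gateAt c (swapGate n L A) (embed (withFirst 0) χ) = embed (withSecond 0) χ := by
  suffices h : gateAt c (swapGate n L A) ∘L embed (withFirst 0) = embed (withSecond 0) from
    DFunLike.congr_fun h χ
  refine clm_ext_ket fun d => ?_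
  rw [ContinuousLinearMap.comp_apply, embed_ket, embed_ket, gateAt, conjRelabel_ket, swapGate,
    LocalIsometry.tensor_ofInjective, embed_ket, relabel_ket]
  congr 1
  rw [Equiv.symm_apply_eq]
  exact Finsupp.ext fun x => rfl

namespace HasRadius

/-- The sequence of offsets of the gates: each offset once, and then `0`. -/
def offsets (n r : ℕ) (a : ℕ) : Fin n → Fin (2 * r + 1) :=
  (Finset.univ : Finset (Fin n → Fin (2 * r + 1))).toList.getD a 0

/-- The sequence of gates: a conjugated swap for each offset, and then a swap. -/
def gates (hG : HasRadius r G) (a : ℕ) :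
    LocalIsometry (Block n (2 * r + 1) (A × A)) (Block n (2 * r + 1) (A × A)) :=
  if a < (Finset.univ : Finset (Fin n → Fin (2 * r + 1))).toList.length then hG.gate
  else swapGate n (2 * r + 1) A

/-- Different offsets exchange disjoint sets of cells, so successive exchanges merge into a single
one on the union. -/
theorem map_restrict_circuit (hG : HasRadius r G) (Ψ : StateSpace n (A × A)) (a : ℕ)
    (ha : a ≤ (Finset.univ : Finset (Fin n → Fin (2 * r + 1))).toList.length)
    (b β : Config n A) :
    G (restrict (withSecond β) (circuit (offsets n r) hG.gates a Ψ)) b =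
      G (restrict (withSecond (mix {y | offsetOf (2 * r + 1) (y - fun _ => (r : ℤ)) ∈
        (Finset.univ : Finset (Fin n → Fin (2 * r + 1))).toList.take a} β b)) Ψ)
        (mix {y | offsetOf (2 * r + 1) (y - fun _ => (r : ℤ)) ∈
          (Finset.univ : Finset (Fin n → Fin (2 * r + 1))).toList.take a} b β) := by
  have hnodup := Finset.nodup_toList (Finset.univ : Finset (Fin n → Fin (2 * r + 1)))
  generalize hl : (Finset.univ : Finset (Fin n → Fin (2 * r + 1))).toList = l at *
  induction a generalizing b β with
  | zero =>
    simp only [List.take_zero, List.not_mem_nil, Set.ofPred_false, mix_empty]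
    rfl
  | succ a ih =>
    have ha' : a < l.length := ha
    have hgate : hG.gates a = hG.gate := if_pos (by rwa [hl])
    have hoff : offsets n r a = l[a] := by
      rw [offsets, hl, List.getD_eq_getElem _ _ ha']
    have htake : l.take (a + 1) = l.take a ++ [l[a]] := by
      rw [List.take_append_getElem]
    have hset : {y : Grid n | offsetOf (2 * r + 1) (y - fun _ => (r : ℤ)) ∈ l.take (a + 1)} =
        {y | offsetOf (2 * r + 1) (y - fun _ => (r : ℤ)) ∈ l.take a} ∪ exchanged r l[a] := by
      ext y
      rw [Set.mem_union, mem_exchanged_iff]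
      change _ ∈ l.take (a + 1) ↔ _ ∈ l.take a ∨ _
      rw [htake, List.mem_append, List.mem_singleton]
    have hdisj : Disjoint {y : Grid n | offsetOf (2 * r + 1) (y - fun _ => (r : ℤ)) ∈ l.take a}
        (exchanged r l[a]) := by
      rw [Set.disjoint_left]
      intro y hy hy'
      rw [mem_exchanged_iff] at hy'
      rw [Set.mem_ofPred_eq, hy'] at hy
      have h := hnodup.sublist (List.take_sublist (a + 1) l)
      rw [htake] at h
      exact (List.disjoint_of_nodup_append h) hy (by simp)
    change G (restrict (withSecond β) (gateAt (offsets n r a) (hG.gates a)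
      (circuit (offsets n r) hG.gates a Ψ))) b = _
    rw [hgate, hoff, hG.map_restrict_gateAt, ih _ _ (by omega), mix_mix hdisj, mix_mix hdisj, hset]

/-- After every offset has been used, all cells are exchanged: `(G ⊗ 1)` of the output is `|0⟩ ⊗
Gψ`. By quiescence this is also its value at `|0⟩ ⊗ Gψ`, and injectivity identifies the output. The
final swap brings `Gψ` back to the first layer. -/
theorem circuit_apply (hG : HasRadius r G) (ψ : StateSpace n A) :
    circuit (offsets n r) hG.gates
      ((Finset.univ : Finset (Fin n → Fin (2 * r + 1))).toList.length + 1)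
      (embed (withSecond 0) ψ) = embed (withSecond 0) (G ψ) := by
  classical
  have key : circuit (offsets n r) hG.gates
      (Finset.univ : Finset (Fin n → Fin (2 * r + 1))).toList.length
      (embed (withSecond 0) ψ) = embed (withFirst 0) (G ψ) := by
    refine hG.ext_map_restrict fun b β => ?_
    rw [hG.map_restrict_circuit _ _ le_rfl]
    simp only [List.take_length, Finset.mem_toList, Finset.mem_univ, Set.ofPred_true, mix_univ]
    have h1 : restrict (withSecond β) (embed (withFirst 0) (G ψ)) = G ψ β • ket 0 := by
      ext d
      rw [restrict_apply, lp.coeFn_smul, Pi.smul_apply, ket_apply, smul_eq_mul]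
      split_ifs with hd
      · subst hd
        rw [mul_one]
        exact embed_apply (withFirst 0) (G ψ) β
      · rw [mul_zero]
        refine embed_apply_of_notMem _ _ ?_
        rintro ⟨β', h⟩
        exact hd (layers_inj.1 h).1.symm
    have h2 : restrict (withSecond b) (embed (withSecond 0) ψ) = if b = 0 then ψ else 0 := by
      ext d
      rw [restrict_apply]
      split_ifs with hb
      · subst hb
        exact embed_apply _ _ _
      · refine embed_apply_of_notMem _ _ ?_
        rintro ⟨b', h⟩
        exact hb (layers_inj.1 h).2.symm
    rw [h1, h2, map_smul, hG.quiescent, lp.coeFn_smul, Pi.smul_apply, ket_apply]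
    split_ifs
    · simp
    · rw [map_zero]
      simp
  have hgate : hG.gates (Finset.univ : Finset (Fin n → Fin (2 * r + 1))).toList.length =
      swapGate n (2 * r + 1) A := if_neg (lt_irrefl _)
  rw [circuit, ContinuousLinearMap.comp_apply, key, hgate, gateAt_swapGate]

/-- A quiescent QCA is intrinsically simulated by a PQCA. -/
theorem exists_intrinsicallySimulates (hG : HasRadius r G) :
    ∃ (B : Type u) (_ : Fintype B) (_ : Zero B) (_ : DecidableEq B)
      (U : ScatteringUnitary n B), IntrinsicallySimulates U G := by
  -- Past the end of the list the offset takes its default value 0: the final swap happens at offset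
  -- 0, as required for returning to the initial encoding.
  obtain ⟨k, hk0, U, hk, hU⟩ := exists_evolution_eq_circuit (offsets n r) hG.gates
    (Finset.univ : Finset (Fin n → Fin (2 * r + 1))).toList.length
    (List.getD_eq_default _ _ le_rfl)
  have h1 : Function.Injective (track (0 : Fin k) ∘ split 0 :
      Block n (2 * r + 1) (A × A) → _) := (track_injective 0).comp (split_injective 0)
  have h2 : (track (0 : Fin k) ∘ split 0 : Block n (2 * r + 1) (A × A) → _) 0 = 0 := by
    simp [split_zero]
  specialize hU h1 h2
  -- One supercell of side `2r + 1`, with an empty second layer, is encoded in one hypercube of side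
  -- 2.
  let f : Block n (2 * r + 1) A → Block n 2 (Fin k → Block n (2 * r + 1) (A × A)) :=
    fun w => (track (0 : Fin k) ∘ split 0) fun p => (w p, 0)
  have hf : Function.Injective f := fun w w' h => by
    funext p
    exact congrArg Prod.fst (congrFun (h1 h) p)
  have hf0 : f 0 = 0 := h2
  refine ⟨_, inferInstance, inferInstance, inferInstance, U, 2 * r + 1, 2, k, inferInstance,
    inferInstance, even_two, ⟨_, hk.trans (two_mul _)⟩, by omega,
    LocalIsometry.ofInjective f hf hf0, ?_⟩
  have hcode : ∀ a : Config n A,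
      group 2 (encoding (group (2 * r + 1)) (track (0 : Fin k) ∘ split 0) h1 h2 0 (layers a 0)) =
        mapConfig n f hf hf0 (group (2 * r + 1) a) := by
    intro a
    simp only [encoding, hypercubes_of_even Even.zero, Function.Embedding.trans_apply,
      Equiv.coe_toEmbedding, Equiv.apply_symm_apply]
    exact Finsupp.ext fun x => rfl
  rw [LocalIsometry.tensor_ofInjective]
  refine clm_ext_ket fun d => ?_
  obtain ⟨a, rfl⟩ := (group (2 * r + 1)).surjective d
  rw [ContinuousLinearMap.comp_apply, ContinuousLinearMap.comp_apply, embed_ket, grouped, grouped,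
    conjRelabel_ket, conjRelabel_ket, Equiv.symm_apply_apply, ← hcode, Equiv.symm_apply_apply]
  have hev := DFunLike.congr_fun hU (embed (withSecond 0) (ket a))
  rw [ContinuousLinearMap.comp_apply, ContinuousLinearMap.comp_apply, hG.circuit_apply,
    embed_ket, embed_ket] at hev
  change U.evolution k (ket (encoding _ _ _ _ _ (layers a 0))) = _ at hev
  rw [hev, relabel_eq_embed, relabel_eq_embed, embed_trans, embed_trans, embed_trans]
  congr 2
  ext1 c
  exact hcode c

end HasRadius

end CircuitOfQCA

/-! ### Normalization of the phase -/

section Phase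

variable {n : ℕ} {A : Type u} [Zero A] {G : Op n A}

theorem translation_zero (ψ : StateSpace n A) : translation (0 : Grid n) ψ = ψ := by
  rw [translation, shift_zero]
  rfl

theorem translation_add (v w : Grid n) (ψ : StateSpace n A) :
    translation (v + w) ψ = translation v (translation w ψ) := by
  ext c
  simp only [translation_apply]
  refine congrArg (fun d => ψ d) (Finsupp.ext fun x => ?_)
  simp only [shift_symm_apply, sub_sub, add_comm v w]

/-- The vectors whose translation commutes with `G` form a subgroup, and the unit vectors generate
the grid. -/
theorem TranslationInvariant.translation_comm (hG : TranslationInvariant G) (v : Grid n)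
    (ψ : StateSpace n A) : G (translation v ψ) = translation v (G ψ) := by
  let H : AddSubgroup (Grid n) :=
    { carrier := {v | ∀ ψ, G (translation v ψ) = translation v (G ψ)}
      zero_mem' := fun ψ => by rw [translation_zero, translation_zero]
      add_mem' := fun {v w} hv hw ψ => by rw [translation_add, hv, hw, ← translation_add]
      neg_mem' := fun {v} hv ψ => by
        apply (translation v).injective
        rw [← hv, ← translation_add, ← translation_add, add_neg_cancel, translation_zero,
          translation_zero] }
  have hv : v ∈ H := by
    have h : v = ∑ k, v k • (Pi.single k (1 : ℤ) : Grid n) := by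
      funext i
      simp [Finset.sum_apply, Pi.single_apply]
    rw [h]
    exact sum_mem fun k _ => zsmul_mem (show Pi.single k (1 : ℤ) ∈ H from hG k) _
  exact hv ψ

/-- Two equal translates would make `c` periodic, and a nonzero periodic configuration has infinite
support. -/
theorem shift_injective_of_ne_zero (k : Fin n) {c : Config n A} (hc : c ≠ 0) :
    Function.Injective fun j : ℕ => shift (j • (Pi.single k (1 : ℤ) : Grid n)) c := by
  classical
  obtain ⟨x, hx⟩ : ∃ x, c x ≠ 0 := by
    by_contra! h
    exact hc (Finsupp.ext h)
  have key : ∀ j d : ℕ, shift (j • (Pi.single k (1 : ℤ) : Grid n)) c =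
      shift ((j + (d + 1)) • (Pi.single k (1 : ℤ) : Grid n)) c → False := by
    intro j d h
    have hper : ∀ y, c y = c (y + (d + 1) • (Pi.single k (1 : ℤ) : Grid n)) := by
      intro y
      have := DFunLike.congr_fun h (y - j • (Pi.single k (1 : ℤ) : Grid n))
      simp only [shift_apply] at this
      rw [sub_add_cancel] at this
      rw [this, add_smul]
      congr 1
      abel
    have hmul : ∀ m : ℕ, c (x + m • ((d + 1) • (Pi.single k (1 : ℤ) : Grid n))) = c x := by
      intro m
      induction m with
      | zero => simp
      | succ m ih =>
        rw [← ih, hper (x + m • _), succ_nsmul, add_assoc]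
    have hinj : Function.Injective
        fun m : ℕ => x + m • ((d + 1) • (Pi.single k (1 : ℤ) : Grid n)) := by
      intro m m' h
      have := congrFun h k
      simp only [Pi.add_apply, Pi.smul_apply, Pi.single_eq_same, add_right_inj] at this
      simp only [nsmul_eq_mul, mul_one] at this
      have h' : ((d + 1 : ℕ) : ℤ) ≠ 0 := by positivity
      exact_mod_cast mul_right_cancel₀ h' this
    refine Set.infinite_range_of_injective hinj (c.support.finite_toSet.subset ?_)
    rintro _ ⟨m, rfl⟩
    exact Finsupp.mem_support_iff.2 (by rwa [hmul m])
  intro j j' h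
  rcases lt_trichotomy j j' with hlt | heq | hlt
  · obtain ⟨d, rfl⟩ := Nat.exists_eq_add_of_lt hlt
    exact (key j d h).elim
  · exact heq
  · obtain ⟨d, rfl⟩ := Nat.exists_eq_add_of_lt hlt
    exact (key j' d h.symm).elim

/-- An invariant vector is constant on the infinite orbit of each nonempty configuration, so
square-summability forces that constant to be 0. An axis `k` is needed for the orbits to be
infinite. -/
theorem eq_smul_ket_zero_of_translation_eq (k : Fin n) {χ : StateSpace n A}
    (h : ∀ v, translation v χ = χ) : χ = χ 0 • ket 0 := by
  classical
  ext c
  rw [lp.coeFn_smul, Pi.smul_apply, ket_apply, smul_eq_mul]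
  split_ifs with hc
  · rw [hc, mul_one]
  · rw [mul_zero]
    have hsum := (memℓp_gen_iff (p := 2) (by norm_num)).1 (lp.memℓp χ)
    have h1 := hsum.comp_injective (shift_injective_of_ne_zero k hc)
    have h2 : ∀ j : ℕ, χ (shift (j • (Pi.single k (1 : ℤ) : Grid n)) c) = χ c := by
      intro j
      have := congrArg (fun φ : StateSpace n A => φ (shift (j • (Pi.single k (1 : ℤ) : Grid n)) c))
        (h (j • (Pi.single k (1 : ℤ) : Grid n)))
      simp only [translation_apply, Equiv.symm_apply_apply] at this
      exact this.symm
    have h3 : Summable fun _ : ℕ => ‖χ c‖ ^ (2 : ENNReal).toReal := by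
      refine h1.congr fun j => ?_
      simp only [Function.comp_apply, h2]
    rw [summable_const_iff] at h3
    simpa using h3

theorem IsQCA.exists_phase (hn : 1 ≤ n) (hG : IsQCA G) :
    ∃ z : ℂ, ‖z‖ = 1 ∧ (z • G) (ket 0) = ket 0 := by
  have h1 := eq_smul_ket_zero_of_translation_eq ⟨0, hn⟩ (χ := G (ket 0)) fun v => by
    rw [← hG.translationInvariant.translation_comm, translation_ket]
    congr 1
  obtain ⟨lam, hlam⟩ : ∃ lam : ℂ, G (ket 0) = lam • ket 0 := ⟨_, h1⟩
  have hnorm : ‖lam‖ = 1 := by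
    have h2 : ‖G (ket 0)‖ = 1 := by
      rw [ContinuousLinearMap.norm_map_of_mem_unitary hG.unitary, norm_ket]
    rwa [hlam, norm_smul, norm_ket, mul_one] at h2
  have hne : lam ≠ 0 := fun h => by simp [h] at hnorm
  refine ⟨lam⁻¹, by rw [norm_inv, hnorm, inv_one], ?_⟩
  rw [smul_apply, hlam, smul_smul, inv_mul_cancel₀ hne, one_smul]

theorem IsQCA.exists_hasRadius (hG : IsQCA G) {z : ℂ} (hz : ‖z‖ = 1)
    (h0 : (z • G) (ket 0) = ket 0) : ∃ r, HasRadius r (z • G) := by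
  obtain ⟨N, hN⟩ := hG.causal
  have hzz : (starRingEnd ℂ) z * z = 1 := by
    rw [mul_comm, Complex.mul_conj, Complex.normSq_eq_norm_sq, hz]; simp
  -- The radius is the largest absolute value of a coordinate in the neighbourhood. The phase
  -- cancels in all correlations.
  refine ⟨N.sup fun y => Finset.univ.sup fun i => (y i).natAbs, ?_, ?_, h0, ?_⟩
  · have h := Unitary.mem_iff.1 hG.unitary
    rw [Unitary.mem_iff]
    constructor
    · rw [star_smul, smul_mul_smul_comm, h.1]
      change ((starRingEnd ℂ) z * z) • _ = _
      rw [hzz, one_smul]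
    · rw [star_smul, smul_mul_smul_comm, h.2, mul_comm]
      change ((starRingEnd ℂ) z * z) • _ = _
      rw [hzz, one_smul]
  · intro v ψ
    rw [smul_apply, smul_apply,
      hG.translationInvariant.translation_comm, map_smul]
  · intro x u v
    have hcorr : (fun c c' => corr (z • G) x u v (ket c) (ket c')) =
        fun c c' => corr G x u v (ket c) (ket c') := by
      funext c c'
      simp only [corr, smul_apply, map_smul, inner_smul_left, inner_smul_right]
      rw [← mul_assoc, mul_comm z, hzz, one_mul]
    rw [hcorr]
    refine (hN.isLocalOn x u v).mono fun y hy i => ?_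
    obtain ⟨w, hw, rfl⟩ := Finset.mem_map.1 (Finset.mem_coe.1 hy)
    have h1 : (w i).natAbs ≤ Finset.univ.sup fun i => (w i).natAbs :=
      Finset.le_sup (f := fun i => (w i).natAbs) (Finset.mem_univ i)
    have h2 := Finset.le_sup (f := fun y : Grid n => Finset.univ.sup fun i => (y i).natAbs) hw
    have h3 : (addLeftEmbedding x w) i - x i = w i := by simp
    rw [h3, Int.abs_eq_natAbs]
    exact_mod_cast h1.trans h2

end Phase

end QCA

end

theorem theorem2 (n : ℕ) (hn : 1 ≤ n) (A : Type u) [Fintype A] [Zero A] [DecidableEq A]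
    (G : QCA.Op n A) (hG : QCA.IsQCA G) :
    ∃ z : ℂ, ‖z‖ = 1 ∧ (z • G) (QCA.ket 0) = QCA.ket 0 ∧
      ∃ (B : Type u) (_ : Fintype B) (_ : Zero B) (_ : DecidableEq B)
        (U : QCA.ScatteringUnitary n B), QCA.IntrinsicallySimulates U (z • G) := by
  obtain ⟨z, hz, h0⟩ := hG.exists_phase hn
  obtain ⟨r, hr⟩ := hG.exists_hasRadius hz h0
  exact ⟨z, hz, h0, hr.exists_intrinsicallySimulates⟩
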